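/- Let $0<R_1\le R_2\le D$ and $\lambda\ge 0$. Let $\Phi$ (the legitimate nodes) be a homogeneous Poisson point process of intensity $\lambda$ on the planar disk $\mathcal B(o,D)$ of radius $D$ centred at the origin $o$. Given $\Phi$, each node $x\in\Phi$ independently becomes a jammer: with probability $1$ if $\|x\|\le R_1$, with probability $P(\|x\|)$ if $R_1<\|x\|\le R_2$, and never if $\|x\|>R_2$. Here $P(r)=p$ with $p\in[0,1]$ under Policy $\mathrm E$, and, when $R_1<R_2$, $P(r)=\frac{r^4-R_1^4}{R_2^4-R_1^4}$ under Policy $\mathrm I$ and $P(r)=\frac{R_2^4-r^4}{R_2^4-R_1^4}$ under Policy $\mathrm D$. Let $\Phi_J$ be the set of jammers, fix $y\in\mathcal B(o,D)$, and let $I(y)=\sum_{x\in\Phi_J}h_{x,y}\|x-y\|^{-4}$ (path loss exponent $\alpha=4$), where the fading coefficients $h_{x,y}$ are i.i.d. exponential with mean $1$ and independent of $\Phi$ and of the selection. For $s>0$ put $\mathcal L(s)=\mathbb E[e^{-sI(y)}]$ and, writing $a=\|y\|$, for $r>0$, $$g(r)=(r^2-a^2)^2-s,\qquad \eta(r)=\frac{\sqrt{\sqrt{g(r)^2+4s(r^2+a^2)^2}+g(r)}}{\sqrt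 2},\qquad \psi(r)=\frac{\sqrt s\,(r^2+a^2)}{\eta(r)},\qquad \theta(r)=\arctan\frac{\sqrt s+\psi(r)}{\eta(r)+r^2-a^2}.$$ Then, for every $s>0$, under Policy $\mathrm E$, $$\mathcal L^{\mathrm E}(s)=\exp\Big\{-\lambda\pi\sqrt s\Big[\frac{\pi}{2}-(1-p)\,\theta(R_1)-p\,\theta(R_2)\Big]\Big\},$$ and, if $R_1<R_2$, under Policies $\Xi=\mathrm I,\mathrm D$, $$\mathcal L^{\Xi}(s)=\exp\Big\{-\lambda\pi\sqrt s\Big[\frac{\pi}{2}-\theta(R_1)+\Psi_4^{\Xi}(R_2)-\Psi_4^{\Xi}(R_1)\Big]\Big\},$$ where $$\Psi_4^{\mathrm I}(r)=\frac{2\sqrt s\,a^2}{R_2^4-R_1^4}\ln\!\big[(\eta(r)+r^2-a^2)^2+(\sqrt s+\psi(r))^2\big]-\frac{(r^2+3a^2)\psi(r)-3\sqrt s\,\eta(r)}{2(R_2^4-R_1^4)}+\frac{s+R_1^4-a^4}{R_2^4-R_1^4}\,\theta(r),$$ $$\Psi_4^{\mathrm D}(r)=-\frac{2\sqrt s\,a^2}{R_2^4-R_1^4}\ln\!\big[(\eta(r)+r^2-a^2)^2+(\sqrt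 s+\psi(r))^2\big]+\frac{(r^2+3a^2)\psi(r)-3\sqrt s\,\eta(r)}{2(R_2^4-R_1^4)}-\frac{s+R_2^4-a^4}{R_2^4-R_1^4}\,\theta(r).$$ -/

import Mathlib

open MeasureTheory ProbabilityTheory
open scoped ENNReal NNReal

namespace FriendlyJamming

/-- The Euclidean plane. -/
abbrev Plane : Type := EuclideanSpace ℝ (Fin 2)

section Model

variable {Ω : Type*} [MeasurableSpace Ω]

/-- The number of the points `X 0, …, X (N - 1)` that lie in `A`. -/
noncomputable def count (N : Ω → ℕ) (X : ℕ → Ω → Plane) (A : Set Plane) (ω : Ω) : ℕ :=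
  ∑ i ∈ Finset.range (N ω), A.indicator (fun _ => (1 : ℕ)) (X i ω)

/-- The finite random point set `{X 0, …, X (N - 1)}` (in some measurable enumeration) is a
Poisson point process with finite intensity measure `Lam`: the number of points in a measurable
set `A` is Poisson with mean `Lam A`, and the numbers of points in pairwise disjoint measurable
sets are independent. Only the first `N` entries of the sequence `X` are points. -/
structure IsPoissonProcess (μ : Measure Ω) (Lam : Measure Plane)
    (N : Ω → ℕ) (X : ℕ → Ω → Plane) : Prop where
  measurable_card : Measurable N
  measurable_point : ∀ i, Measurable (X i)
  map_count : ∀ A : Set Plane, MeasurableSet A →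
    μ.map (count N X A) = poissonMeasure (Lam A).toNNReal
  iIndep_count : ∀ (n : ℕ) (A : Fin n → Set Plane), (∀ k, MeasurableSet (A k)) →
    Pairwise (fun j k => Disjoint (A j) (A k)) → iIndepFun (fun k => count N X (A k)) μ

/-- The intensity measure of the legitimate nodes: `lam` times the area, on the disk of
radius `D` centred at the origin. -/
noncomputable def nodeIntensity (lam D : ℝ) : Measure Plane :=
  ENNReal.ofReal lam • (volume : Measure Plane).restrict (Metric.closedBall 0 D)

/-- The probability with which a node at distance `r` from the transmitter (the origin) serves
as a jammer: always in the local friendship circle of radius `R₁`, with probability `P r` in the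
long-range friendship annulus between `R₁` and `R₂`, never outside. -/
noncomputable def jamProb (R₁ R₂ : ℝ) (P : ℝ → ℝ) (r : ℝ) : ℝ :=
  if r ≤ R₁ then 1 else if r ≤ R₂ then P r else 0

/-- The friendship-based cooperative jamming model.
The legitimate nodes are `X i`, `i < N`; `J i` tells whether node `i` serves as a jammer;
`h i` is the fading coefficient of the channel from node `i` to the location under consideration.
* The nodes form a homogeneous Poisson process of intensity `lam` on the disk of radius `D`.
* Given all the locations, the nodes become jammers independently of each other, the node `x`
  with probability `jamProb R₁ R₂ P ‖x‖`: any given nodes `i ∈ s` are all jammers with conditional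
  probability the product of these probabilities.
* The fading coefficients are independent exponential variables of mean one, and independent of
  the locations and of the selection. -/
structure IsJammingNetwork (μ : Measure Ω) (lam D R₁ R₂ : ℝ) (P : ℝ → ℝ)
    (N : Ω → ℕ) (X : ℕ → Ω → Plane) (J : ℕ → Ω → Bool) (h : ℕ → Ω → ℝ) : Prop where
  poisson : IsPoissonProcess μ (nodeIntensity lam D) N X
  measurable_jam : ∀ i, Measurable (J i)
  thinning : ∀ s : Finset ℕ, ∀ᵐ ω ∂μ, (∀ i ∈ s, i < N ω) →
    (μ[{ω' | ∀ i ∈ s, J i ω' = true}.indicator (fun _ => (1 : ℝ)) |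
      MeasurableSpace.comap (fun ω' => (N ω', fun i => X i ω')) inferInstance]) ω
      = ∏ i ∈ s, jamProb R₁ R₂ P ‖X i ω‖
  measurable_fading : ∀ i, Measurable (h i)
  map_fading : ∀ i, μ.map (h i) = expMeasure 1
  iIndep_fading : iIndepFun h μ
  indep_fading : IndepFun (fun ω i => h i ω)
    (fun ω => (N ω, (fun i => X i ω), (fun i => J i ω))) μ

/-- The sum interference at `y` with path loss exponent `α`. -/
noncomputable def interference (α : ℝ) (N : Ω → ℕ) (X : ℕ → Ω → Plane) (J : ℕ → Ω → Bool)
    (h : ℕ → Ω → ℝ) (y : Plane) (ω : Ω) : ℝ :=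
  ∑ i ∈ Finset.range (N ω), if J i ω = true then h i ω * ‖X i ω - y‖ ^ (-α) else 0

/-- The Laplace transform `𝔼[exp (-s I)]` of a random variable `I`. -/
noncomputable def laplaceTransform (μ : Measure Ω) (I : Ω → ℝ) (s : ℝ) : ℝ :=
  ∫ ω, Real.exp (-s * I ω) ∂μ

end Model

/-- Policy E: constant selection probability. -/
def policyE (p : ℝ) : ℝ → ℝ := fun _ => p

/-- Policy I: the selection probability increases with the distance. -/
noncomputable def policyI (α R₁ R₂ : ℝ) : ℝ → ℝ :=
  fun r => (r ^ α - R₁ ^ α) / (R₂ ^ α - R₁ ^ α)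

/-- Policy D: the selection probability decreases with the distance. -/
noncomputable def policyD (α R₁ R₂ : ℝ) : ℝ → ℝ :=
  fun r => (R₂ ^ α - r ^ α) / (R₂ ^ α - R₁ ^ α)

/-- The auxiliary function `g`; here and below, the last argument `a` is `‖y‖`. -/
def g (r s a : ℝ) : ℝ := (r ^ 2 - a ^ 2) ^ 2 - s

/-- The auxiliary function `η`. -/
noncomputable def eta (r s a : ℝ) : ℝ :=
  √(√((g r s a) ^ 2 + 4 * s * (r ^ 2 + a ^ 2) ^ 2) + g r s a) / √2

/-- The auxiliary function `ψ`. -/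
noncomputable def psi (r s a : ℝ) : ℝ := √s * (r ^ 2 + a ^ 2) / eta r s a

/-- The function `Ψ₄` of Policy I. -/
noncomputable def PsiI (R₁ R₂ r s a : ℝ) : ℝ :=
  2 * √s * a ^ 2 / (R₂ ^ 4 - R₁ ^ 4)
      * Real.log ((eta r s a + r ^ 2 - a ^ 2) ^ 2 + (√s + psi r s a) ^ 2)
    - 1 / (2 * (R₂ ^ 4 - R₁ ^ 4)) * ((r ^ 2 + 3 * a ^ 2) * psi r s a - 3 * √s * eta r s a)
    + (s + R₁ ^ 4 - a ^ 4) / (R₂ ^ 4 - R₁ ^ 4)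
      * Real.arctan ((√s + psi r s a) / (eta r s a + r ^ 2 - a ^ 2))

/-- The function `Ψ₄` of Policy D. -/
noncomputable def PsiD (R₁ R₂ r s a : ℝ) : ℝ :=
  -(2 * √s * a ^ 2 / (R₂ ^ 4 - R₁ ^ 4))
      * Real.log ((eta r s a + r ^ 2 - a ^ 2) ^ 2 + (√s + psi r s a) ^ 2)
    + 1 / (2 * (R₂ ^ 4 - R₁ ^ 4)) * ((r ^ 2 + 3 * a ^ 2) * psi r s a - 3 * √s * eta r s a)
    - (s + R₂ ^ 4 - a ^ 4) / (R₂ ^ 4 - R₁ ^ 4)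
      * Real.arctan ((√s + psi r s a) / (eta r s a + r ^ 2 - a ^ 2))

end FriendlyJamming

open FriendlyJamming

namespace FriendlyJamming

/-! ### Exponential and Poisson distributions -/

/-! Probabilistic half: integrating out the independent fading turns a jammer at distance d from y
into the factor 1/(1 + s d⁻⁴). Averaging over the selection turns each node into 1 - q(‖x‖)(1 - 1/(1
+ s d⁻⁴)), where q is `jamProb`. The Poisson Laplace functional then gives exp(-∫ q(‖x‖) s/(s + d⁴))
against the intensity. `IsJammingNetwork.laplaceTransform_interference` combines the three.

Analytic half: with t = d² the integrand is s/(s + t²) = -√s Im 1/(t + i√s). In polar coordinates t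
= r² + a² - 2ra cos φ, and ∫ dφ/(A - B cos φ) = 2π/√(A² - B²) does the angular integral, with A = r²
+ a² + i√s and B = 2ra. The root is S = η + iψ. For u = r² and w = u - a² + i√s one has S² = w² +
4i√s a², and r dr = du/2. Since every policy is affine in r⁴ = u², only the primitives of 1/S and
u²/S are needed (`logPrim`, `sqPrim`). The first is log(w + S), whose imaginary part is θ for r > 0
and π/2 at r = 0. The formulas follow by taking imaginary parts. -/

lemma ae_nonneg_expMeasure : ∀ᵐ x ∂(expMeasure 1), 0 ≤ x := by
  rw [ae_iff]
  have : {x : ℝ | ¬ 0 ≤ x} = Set.Iio 0 := by ext; simp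
  rw [this, expMeasure, gammaMeasure, withDensity_apply _ measurableSet_Iio]
  exact lintegral_exponentialPDF_of_nonpos le_rfl

lemma integral_exp_neg_mul_expMeasure {t : ℝ} (ht : 0 ≤ t) :
    ∫ x, Real.exp (-(t * x)) ∂(expMeasure 1) = (1 + t)⁻¹ := by
  have hpdf : gammaPDF 1 1 = exponentialPDF 1 := rfl
  have hmeas : Measurable (exponentialPDF 1) := (measurable_exponentialPDFReal 1).ennreal_ofReal
  rw [expMeasure, gammaMeasure, hpdf, integral_withDensity_eq_integral_toReal_smul hmeas
    (Filter.Eventually.of_forall fun x => by simp [exponentialPDF])]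
  have h1 : ∀ x : ℝ, (exponentialPDF 1 x).toReal • Real.exp (-(t * x))
      = (Set.Ici (0 : ℝ)).indicator (fun x => Real.exp ((-(1 + t)) * x)) x := by
    intro x
    rw [exponentialPDF_eq]
    by_cases hx : 0 ≤ x
    · rw [Set.indicator_of_mem (Set.mem_Ici.mpr hx), if_pos hx,
        ENNReal.toReal_ofReal (by positivity), smul_eq_mul, one_mul, ← Real.exp_add]
      congr 1; ring
    · rw [Set.indicator_of_notMem (by simpa using hx), if_neg hx]
      simp
  simp_rw [h1]
  rw [integral_indicator measurableSet_Ici, integral_Ici_eq_integral_Ioi,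
    integral_exp_mul_Ioi (by linarith)]
  simp
  rw [neg_div, ← neg_add_rev, div_neg, neg_neg, one_div, add_comm]

/-- The generating function is an exponential series in r x. It evaluates the contribution of one
level set to the Laplace functional. -/
lemma integral_pow_poissonMeasure (r : ℝ≥0) (x : ℝ) :
    ∫ n, x ^ n ∂(poissonMeasure r) = Real.exp (-((1 - x) * r)) := by
  rw [integral_poissonMeasure]
  have h := (NormedSpace.expSeries_div_hasSum_exp (r * x : ℝ)).mul_left (Real.exp (-r))
  rw [← Real.exp_eq_exp_ℝ, ← Real.exp_add] at h
  convert h.tsum_eq using 1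
  · refine tsum_congr fun n => ?_
    rw [smul_eq_mul, mul_pow]; ring
  · congr 1; ring

/-! ### The Laplace functional of a Poisson process -/

section Functional

variable {Ω : Type*} [MeasurableSpace Ω]

/-- The index range is random but takes countably many values, so measurability can be checked for
each fixed value of N. -/
lemma measurable_prod_range {N : Ω → ℕ} (hN : Measurable N) {F : ℕ → Ω → ℝ}
    (hF : ∀ i, Measurable (F i)) : Measurable fun ω => ∏ i ∈ Finset.range (N ω), F i ω := by
  have h : Measurable fun p : ℕ × Ω => ∏ i ∈ Finset.range p.1, F i p.2 :=
    measurable_from_prod_countable_right fun n => by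
      simpa using Finset.measurable_fun_prod (Finset.range n) fun i _ => hF i
  exact h.comp (hN.prodMk measurable_id)

lemma measurable_count {N : Ω → ℕ} {X : ℕ → Ω → Plane} (hN : Measurable N)
    (hX : ∀ i, Measurable (X i)) {A : Set Plane} (hA : MeasurableSet A) :
    Measurable (count N X A) := by
  have h : Measurable fun p : ℕ × Ω =>
      ∑ i ∈ Finset.range p.1, A.indicator (fun _ => (1 : ℕ)) (X i p.2) :=
    measurable_from_prod_countable_right fun n => by
      simpa using Finset.measurable_fun_sum (Finset.range n) fun i _ =>
        (measurable_const.indicator hA).comp (hX i)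
  exact h.comp (hN.prodMk measurable_id)

lemma prod_mem_Icc_zero_one {ι : Type*} {s : Finset ι} {f : ι → ℝ}
    (hf : ∀ i ∈ s, f i ∈ Set.Icc (0 : ℝ) 1) : ∏ i ∈ s, f i ∈ Set.Icc (0 : ℝ) 1 :=
  ⟨Finset.prod_nonneg fun i hi => (hf i hi).1,
    Finset.prod_le_one (fun i hi => (hf i hi).1) fun i hi => (hf i hi).2⟩

lemma norm_le_one_of_mem_Icc {x : ℝ} (hx : x ∈ Set.Icc (0 : ℝ) 1) : ‖x‖ ≤ 1 := by
  rw [Real.norm_of_nonneg hx.1]; exact hx.2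

variable {μ : Measure Ω} {Lam : Measure Plane} {N : Ω → ℕ} {X : ℕ → Ω → Plane}

/-- The Laplace functional for functions with finitely many levels. -/
lemma IsPoissonProcess.integral_prod_level (hP : IsPoissonProcess μ Lam N X)
    [IsFiniteMeasure Lam] {n : ℕ} {k : Plane → Fin n} (hk : Measurable k) (v : Fin n → ℝ) :
    ∫ ω, ∏ i ∈ Finset.range (N ω), v (k (X i ω)) ∂μ
      = Real.exp (-∫ x, (1 - v (k x)) ∂Lam) := by
  have hA : ∀ j, MeasurableSet (k ⁻¹' {j}) := fun j => hk (measurableSet_singleton j)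
  have hm := fun j => measurable_count hP.measurable_card hP.measurable_point (hA j)
  have hdisj : Pairwise fun i j => Disjoint (k ⁻¹' {i}) (k ⁻¹' {j}) := fun i j hij =>
    Disjoint.preimage _ (by simpa using hij)
  -- Grouping the points by level leaves a product of powers whose exponents are independent Poisson
  -- counts.
  have h1 : ∀ ω, ∏ i ∈ Finset.range (N ω), v (k (X i ω))
      = ∏ j, v j ^ count N X (k ⁻¹' {j}) ω := by
    intro ω
    simp_rw [count, ← Finset.prod_pow_eq_pow_sum]
    rw [Finset.prod_comm]
    refine Finset.prod_congr rfl fun i _ => ?_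
    rw [Finset.prod_eq_single (k (X i ω))]
    · simp
    · intro j _ hj
      rw [Set.indicator_of_notMem, pow_zero]
      simpa using hj.symm
    · simp
  have h2 : ∫ x, (1 - v (k x)) ∂Lam = ∑ j, (1 - v j) * (Lam (k ⁻¹' {j})).toNNReal := by
    have : ∫ x, (1 - v (k x)) ∂Lam = ∫ j, (1 - v j) ∂(Lam.map k) :=
      (integral_map (f := fun j => 1 - v j) hk.aemeasurable
        (measurable_of_countable _).aestronglyMeasurable).symm
    rw [this, integral_fintype Integrable.of_finite]
    refine Finset.sum_congr rfl fun j _ => ?_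
    rw [measureReal_def, Measure.map_apply hk (measurableSet_singleton j), smul_eq_mul, mul_comm]
    rfl
  simp_rw [h1]
  rw [(hP.iIndep_count n _ hA hdisj).integral_fun_prod_comp (f := fun j m => v j ^ m)
    (fun j => (hm j).aemeasurable) (fun j => (measurable_of_countable _).aestronglyMeasurable),
    h2, ← Finset.sum_neg_distrib, Real.exp_sum]
  refine Finset.prod_congr rfl fun j _ => ?_
  rw [← integral_pow_poissonMeasure, ← hP.map_count _ (hA j),
    integral_map (hm j).aemeasurable (measurable_of_countable _).aestronglyMeasurable]

/-- The Laplace functional of a Poisson process with finite intensity measure. -/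
theorem IsPoissonProcess.integral_prod [IsProbabilityMeasure μ] (hP : IsPoissonProcess μ Lam N X)
    [IsFiniteMeasure Lam] {f : Plane → ℝ} (hf : Measurable f) (hf01 : ∀ x, f x ∈ Set.Icc (0 : ℝ) 1) :
    ∫ ω, ∏ i ∈ Finset.range (N ω), f (X i ω) ∂μ = Real.exp (-∫ x, (1 - f x) ∂Lam) := by
  have hlt : ∀ (m : ℕ) x, ⌊f x * m⌋₊ < m + 1 := fun m x => by
    refine Nat.lt_succ_of_le (Nat.floor_le_of_le ?_)
    exact mul_le_of_le_one_left (Nat.cast_nonneg m) (hf01 x).2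
  -- Discretise f to ⌊f m⌋/m. There are m + 1 levels because the value f = 1 is attained at level m;
  -- for m = 0 the quotient is 0, still in [0, 1].
  let k : (m : ℕ) → Plane → Fin (m + 1) := fun m x => ⟨⌊f x * m⌋₊, hlt m x⟩
  let v : (m : ℕ) → Fin (m + 1) → ℝ := fun m j => (j : ℕ) / (m : ℝ)
  have hk : ∀ m, Measurable (k m) := fun m => by
    have : Measurable fun x => ⌊f x * m⌋₊ := Nat.measurable_floor.comp (hf.mul_const _)
    exact this.subtype_mk (h := fun x => hlt m x) |> fun h =>
      (measurable_of_countable (fun i : {i : ℕ // i < m + 1} => (⟨i.1, i.2⟩ : Fin (m + 1)))).comp h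
  have hv01 : ∀ m x, v m (k m x) ∈ Set.Icc (0 : ℝ) 1 := fun m x =>
    ⟨by positivity, div_le_one_of_le₀ (by exact_mod_cast Nat.lt_succ_iff.mp (hlt m x))
      (Nat.cast_nonneg m)⟩
  have hvm : ∀ m, Measurable fun x => v m (k m x) := fun m =>
    (measurable_of_countable (v m)).comp (hk m)
  have hlim : ∀ x, Filter.Tendsto (fun m => v m (k m x)) Filter.atTop (nhds (f x)) := fun x =>
    (tendsto_nat_floor_mul_div_atTop (hf01 x).1).comp tendsto_natCast_atTop_atTop
  have hL : Filter.Tendsto (fun m => ∫ ω, ∏ i ∈ Finset.range (N ω), v m (k m (X i ω)) ∂μ)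
      Filter.atTop (nhds (∫ ω, ∏ i ∈ Finset.range (N ω), f (X i ω) ∂μ)) :=
    tendsto_integral_of_dominated_convergence (fun _ => 1)
      (fun m => (measurable_prod_range hP.measurable_card fun i =>
        (hvm m).comp (hP.measurable_point i)).aestronglyMeasurable)
      (integrable_const _)
      (fun m => Filter.Eventually.of_forall fun ω =>
        norm_le_one_of_mem_Icc (prod_mem_Icc_zero_one fun i _ => hv01 m _))
      (Filter.Eventually.of_forall fun ω => tendsto_finsetProd _ fun i _ => hlim _)
  have hR : Filter.Tendsto (fun m => ∫ x, (1 - v m (k m x)) ∂Lam)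
      Filter.atTop (nhds (∫ x, (1 - f x) ∂Lam)) :=
    tendsto_integral_of_dominated_convergence (fun _ => 1)
      (fun m => ((hvm m).const_sub 1).aestronglyMeasurable)
      (integrable_const _)
      (fun m => Filter.Eventually.of_forall fun x => norm_le_one_of_mem_Icc
        ⟨by linarith [(hv01 m x).2], by linarith [(hv01 m x).1]⟩)
      (Filter.Eventually.of_forall fun x => (hlim x).const_sub 1)
  refine tendsto_nhds_unique hL ?_
  simp_rw [hP.integral_prod_level (hk _)]
  exact (Real.continuous_exp.tendsto _).comp hR.neg

end Functional

/-! ### Fading -/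

section Fading

variable {Ω : Type*} [MeasurableSpace Ω] {μ : Measure Ω} [IsProbabilityMeasure μ]

/-- Integrating out independent exponential variables of mean one. -/
lemma integral_prod_exp_neg_mul {E : Type*} [MeasurableSpace E] {h : ℕ → Ω → ℝ} {V : Ω → E}
    (hm : ∀ i, Measurable (h i)) (hlaw : ∀ i, μ.map (h i) = expMeasure 1)
    (hind : iIndepFun h μ) (hV : Measurable V)
    (hhV : IndepFun (fun ω i => h i ω) V μ) {n : E → ℕ} (hn : Measurable n)
    {t : ℕ → E → ℝ} (ht : ∀ i, Measurable (t i)) (ht0 : ∀ i v, 0 ≤ t i v) :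
    ∫ ω, ∏ i ∈ Finset.range (n (V ω)), Real.exp (-(t i (V ω) * h i ω)) ∂μ
      = ∫ ω, ∏ i ∈ Finset.range (n (V ω)), (1 + t i (V ω))⁻¹ ∂μ := by
  have hH : Measurable fun ω i => h i ω := measurable_pi_lambda _ hm
  have hprod := (indepFun_iff_map_prod_eq_prod_map_map hH.aemeasurable hV.aemeasurable).mp hhV
  let F : (ℕ → ℝ) × E → ℝ := fun p =>
    ∏ i ∈ Finset.range (n p.2), Real.exp (-(t i p.2 * p.1 i))
  have hF : Measurable F := measurable_prod_range (hn.comp measurable_snd) fun i => by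
    have h1 : Measurable fun p : (ℕ → ℝ) × E => t i p.2 := (ht i).comp measurable_snd
    have h2 : Measurable fun p : (ℕ → ℝ) × E => p.1 i := (measurable_pi_apply i).comp measurable_fst
    exact (h1.mul h2).neg.exp
  -- The fading is nonnegative only almost surely, and without this the product need not be bounded
  -- by 1, the bound used for Fubini.
  have hpos : ∀ᵐ ω ∂μ, ∀ i, 0 ≤ h i ω := by
    rw [ae_all_iff]
    intro i
    have := ae_nonneg_expMeasure
    rw [← hlaw i] at this
    exact ae_of_ae_map (hm i).aemeasurable this
  have hFint : Integrable F (μ.map fun ω => ((fun i => h i ω), V ω)) := by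
    rw [integrable_map_measure hF.aestronglyMeasurable (hH.prodMk hV).aemeasurable]
    refine Integrable.of_bound (hF.comp (hH.prodMk hV)).aestronglyMeasurable 1 ?_
    filter_upwards [hpos] with ω hω
    refine norm_le_one_of_mem_Icc (prod_mem_Icc_zero_one fun i _ => ⟨(Real.exp_pos _).le, ?_⟩)
    exact Real.exp_le_one_iff.mpr (neg_nonpos.mpr (mul_nonneg (ht0 _ _) (hω i)))
  have h1 : ∫ ω, ∏ i ∈ Finset.range (n (V ω)), Real.exp (-(t i (V ω) * h i ω)) ∂μ
      = ∫ p, F p ∂(μ.map fun ω => ((fun i => h i ω), V ω)) :=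
    (integral_map (hH.prodMk hV).aemeasurable hF.aestronglyMeasurable).symm
  rw [hprod] at hFint
  have := Measure.isProbabilityMeasure_map (μ := μ) hH.aemeasurable
  have := Measure.isProbabilityMeasure_map (μ := μ) hV.aemeasurable
  -- Under the product law v is frozen, so the number of factors is deterministic and independence
  -- of the h i applies.
  have hinner : ∀ v, ∫ x, F (x, v) ∂(μ.map fun ω i => h i ω)
      = ∏ i ∈ Finset.range (n v), (1 + t i v)⁻¹ := by
    intro v
    have hFv : Measurable fun x => F (x, v) := hF.comp measurable_prodMk_right
    rw [integral_map hH.aemeasurable hFv.aestronglyMeasurable]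
    have hres : iIndepFun (fun i : Finset.range (n v) => h i) μ :=
      hind.precomp Subtype.val_injective
    have h2 := hres.integral_fun_prod_comp
        (f := fun (i : Finset.range (n v)) x => Real.exp (-(t i v * x))) (fun i => (hm _).aemeasurable)
        (fun i => by fun_prop)
    simp only [F]
    rw [← Finset.prod_coe_sort (Finset.range (n v)) fun i => (1 + t i v)⁻¹]
    simp_rw [← Finset.prod_coe_sort (Finset.range (n v)) fun i => Real.exp (-(t i v * h i _))]
    rw [h2]
    refine Finset.prod_congr rfl fun i _ => ?_
    rw [← integral_exp_neg_mul_expMeasure (ht0 i v), ← hlaw i,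
      integral_map (hm i).aemeasurable (by fun_prop)]
  rw [h1, hprod, integral_prod_symm _ hFint]
  simp_rw [hinner]
  rw [integral_map hV.aemeasurable]
  exact (measurable_prod_range hn fun i => ((ht i).const_add 1).inv).aestronglyMeasurable

end Fading

/-! ### Selection of the jammers and the Laplace transform of the interference -/

section Thinning

variable {Ω : Type*} [MeasurableSpace Ω] {μ : Measure Ω} [IsProbabilityMeasure μ]
  {lam D R₁ R₂ : ℝ} {P : ℝ → ℝ} {N : Ω → ℕ} {X : ℕ → Ω → Plane} {J : ℕ → Ω → Bool} {h : ℕ → Ω → ℝ}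

/-- The selection indicators of a finite set of nodes can be replaced by the product of the
selection probabilities when integrating against functions of the locations. -/
lemma IsJammingNetwork.setIntegral_prod_mul_indicator
    (hN : IsJammingNetwork μ lam D R₁ R₂ P N X J h)
    {e : Plane → ℝ} (he : Measurable e) (he1 : ∀ x, |e x| ≤ 1) {n : ℕ} {T : Finset ℕ}
    (hT : T ⊆ Finset.range n) :
    ∫ ω in N ⁻¹' {n}, (∏ i ∈ T, e (X i ω))
        * {ω' | ∀ i ∈ T, J i ω' = true}.indicator (fun _ => (1 : ℝ)) ω ∂μ
      = ∫ ω in N ⁻¹' {n}, ∏ i ∈ T, jamProb R₁ R₂ P ‖X i ω‖ * e (X i ω) ∂μ := by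
  have hNm := hN.poisson.measurable_card
  have hXm := hN.poisson.measurable_point
  set loc : Ω → ℕ × (ℕ → Plane) := fun ω' => (N ω', fun i => X i ω') with hloc
  have hlocm : Measurable loc := hNm.prodMk (measurable_pi_lambda _ hXm)
  have hA : MeasurableSet (N ⁻¹' {n}) := hNm (measurableSet_singleton n)
  have hle : MeasurableSpace.comap loc inferInstance ≤ (inferInstance : MeasurableSpace Ω) :=
    hlocm.comap_le
  set B : Set Ω := {ω' | ∀ i ∈ T, J i ω' = true} with hBdef
  have hB : MeasurableSet B := by
    have : B = ⋂ i ∈ T, J i ⁻¹' {true} := by ext; simp [hBdef]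
    rw [this]
    exact T.measurableSet_biInter fun i _ => hN.measurable_jam i (measurableSet_singleton _)
  -- A function of the locations alone, hence it can be pulled out of the conditional expectation.
  -- The factor for N = n confines it to the event where the indices in T are actual nodes and
  -- `thinning` gives information.
  let w : ℕ × (ℕ → Plane) → ℝ := fun p => (if p.1 = n then 1 else 0) * ∏ i ∈ T, e (p.2 i)
  have hw : Measurable w := by
    refine Measurable.mul ?_ (Finset.measurable_fun_prod _ fun i _ => he.comp ?_)
    · exact Measurable.ite (measurable_fst (measurableSet_singleton n)) measurable_const
        measurable_const
    · exact (measurable_pi_apply i).comp measurable_snd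
  have hwm : StronglyMeasurable[MeasurableSpace.comap loc inferInstance] (w ∘ loc) :=
    (hw.comp (comap_measurable loc)).stronglyMeasurable
  have hw1 : ∀ p, ‖w p‖ ≤ 1 := fun p => by
    simp only [w, norm_mul, Real.norm_eq_abs, Finset.abs_prod]
    refine mul_le_one₀ ?_ (Finset.prod_nonneg fun i _ => abs_nonneg _)
      (Finset.prod_le_one (fun i _ => abs_nonneg _) fun i _ => he1 _)
    split_ifs <;> simp
  have hg : Integrable (B.indicator fun _ => (1 : ℝ)) μ := (integrable_const 1).indicator hB
  have hfg : Integrable ((w ∘ loc) * B.indicator fun _ => (1 : ℝ)) μ :=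
    hg.bdd_mul (hw.comp hlocm).aestronglyMeasurable
      (Filter.Eventually.of_forall fun ω => hw1 (loc ω))
  have hsplit : ∀ (ω : Ω) (c : ℝ), (N ⁻¹' {n}).indicator (fun _ => (∏ i ∈ T, e (X i ω)) * c) ω
      = (w ∘ loc) ω * c := fun ω c => by
    by_cases hω : N ω = n <;> simp [w, hloc, hω]
  rw [← integral_indicator hA, ← integral_indicator hA]
  calc _ = ∫ ω, ((w ∘ loc) * B.indicator fun _ => (1 : ℝ)) ω ∂μ := by
        refine integral_congr_ae (Filter.Eventually.of_forall fun ω => ?_)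
        exact hsplit ω _
    _ = ∫ ω, (μ[(w ∘ loc) * B.indicator (fun _ => (1 : ℝ)) |
          MeasurableSpace.comap loc inferInstance]) ω ∂μ := (integral_condExp hle).symm
    _ = _ := by
        refine integral_congr_ae ?_
        filter_upwards [condExp_mul_of_stronglyMeasurable_left hwm hfg hg, hN.thinning T]
          with ω h1 h2
        rw [h1, Pi.mul_apply]
        by_cases hω : N ω = n
        · rw [h2 fun i hi => by rw [hω]; exact Finset.mem_range.mp (hT hi), ← hsplit,
            Set.indicator_of_mem (by exact hω), Set.indicator_of_mem (by exact hω),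
            ← Finset.prod_mul_distrib]
          exact Finset.prod_congr rfl fun i _ => mul_comm _ _
        · simp [w, hloc, hω]

/-- Integrating out the selection of the jammers. -/
lemma IsJammingNetwork.integral_prod_select
    (hN : IsJammingNetwork μ lam D R₁ R₂ P N X J h)
    (hq : Measurable (jamProb R₁ R₂ P)) (hq01 : ∀ r, jamProb R₁ R₂ P r ∈ Set.Icc (0 : ℝ) 1)
    {c : Plane → ℝ} (hc : Measurable c) (hc01 : ∀ x, c x ∈ Set.Icc (0 : ℝ) 1) :
    ∫ ω, ∏ i ∈ Finset.range (N ω), (if J i ω = true then c (X i ω) else 1) ∂μ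
      = ∫ ω, ∏ i ∈ Finset.range (N ω), (1 - jamProb R₁ R₂ P ‖X i ω‖ * (1 - c (X i ω))) ∂μ := by
  have hNm := hN.poisson.measurable_card
  have hXm := hN.poisson.measurable_point
  have hJm : ∀ i, MeasurableSet {ω | J i ω = true} := fun i =>
    hN.measurable_jam i (measurableSet_singleton true)
  have hA : ∀ n, MeasurableSet (N ⁻¹' {n}) := fun n => hNm (measurableSet_singleton n)
  have hU : (⋃ n, N ⁻¹' {n}) = Set.univ := by
    rw [← Set.preimage_iUnion, Set.iUnion_of_singleton, Set.preimage_univ]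
  have hdisj : Pairwise (Function.onFun Disjoint fun n => N ⁻¹' {n}) := fun i j hij =>
    Disjoint.preimage _ (by simpa using hij)
  have hI1 : Integrable
      (fun ω => ∏ i ∈ Finset.range (N ω), (if J i ω = true then c (X i ω) else 1)) μ := by
    refine Integrable.of_bound (measurable_prod_range hNm fun i =>
      (hc.comp (hXm i)).ite (hJm i) measurable_const).aestronglyMeasurable 1
      (Filter.Eventually.of_forall fun ω =>
        norm_le_one_of_mem_Icc (prod_mem_Icc_zero_one fun i _ => ?_))
    split_ifs
    exacts [hc01 _, ⟨zero_le_one, le_rfl⟩]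
  have hI2 : Integrable (fun ω => ∏ i ∈ Finset.range (N ω),
      (1 - jamProb R₁ R₂ P ‖X i ω‖ * (1 - c (X i ω)))) μ := by
    refine Integrable.of_bound (measurable_prod_range hNm fun i =>
      ((hq.comp (hXm i).norm).mul ((hc.comp (hXm i)).const_sub 1)).const_sub 1).aestronglyMeasurable
      1 (Filter.Eventually.of_forall fun ω =>
        norm_le_one_of_mem_Icc (prod_mem_Icc_zero_one fun i _ => ?_))
    have h1 := hq01 ‖X i ω‖
    have h2 := hc01 (X i ω)
    constructor <;> nlinarith [h1.1, h1.2, h2.1, h2.2]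
  -- Split according to the value of N, so that the products have a fixed range.
  rw [← setIntegral_univ, ← setIntegral_univ (μ := μ) (f := fun ω => ∏ i ∈ Finset.range (N ω),
      (1 - jamProb R₁ R₂ P ‖X i ω‖ * (1 - c (X i ω)))), ← hU,
    integral_iUnion hA hdisj hI1.integrableOn, integral_iUnion hA hdisj hI2.integrableOn]
  refine tsum_congr fun n => ?_
  have he : Measurable fun x => c x - 1 := hc.sub_const 1
  have he1 : ∀ x, |c x - 1| ≤ 1 := fun x =>
    abs_le.mpr ⟨by linarith [(hc01 x).1], by linarith [(hc01 x).2]⟩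
  -- Writing each factor as 1 + (c - 1)·1_J and expanding over subsets T leaves exactly the joint
  -- events "all of T are jammers" that `thinning` controls.
  have hL : ∀ ω ∈ N ⁻¹' {n}, ∏ i ∈ Finset.range (N ω), (if J i ω = true then c (X i ω) else 1)
      = ∑ T ∈ (Finset.range n).powerset, (∏ i ∈ T, (c (X i ω) - 1))
        * {ω' | ∀ i ∈ T, J i ω' = true}.indicator (fun _ => (1 : ℝ)) ω := by
    intro ω hω
    rw [Set.mem_preimage, Set.mem_singleton_iff] at hω
    rw [hω]
    have h1 : ∀ i, (if J i ω = true then c (X i ω) else 1)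
        = 1 + (c (X i ω) - 1) * (if J i ω = true then 1 else 0) := fun i => by
      split_ifs <;> ring
    simp_rw [h1, Finset.prod_one_add, Finset.prod_mul_distrib]
    refine Finset.sum_congr rfl fun T _ => ?_
    rw [Finset.prod_ite_zero]
    simp [Set.indicator]
  have hR : ∀ ω ∈ N ⁻¹' {n}, ∏ i ∈ Finset.range (N ω),
        (1 - jamProb R₁ R₂ P ‖X i ω‖ * (1 - c (X i ω)))
      = ∑ T ∈ (Finset.range n).powerset,
        ∏ i ∈ T, jamProb R₁ R₂ P ‖X i ω‖ * (c (X i ω) - 1) := by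
    intro ω hω
    rw [Set.mem_preimage, Set.mem_singleton_iff] at hω
    rw [hω, ← Finset.prod_one_add]
    exact Finset.prod_congr rfl fun i _ => by ring
  rw [setIntegral_congr_fun (hA n) hL, setIntegral_congr_fun (hA n) hR, integral_finsetSum,
    integral_finsetSum]
  · exact Finset.sum_congr rfl fun T hT =>
      hN.setIntegral_prod_mul_indicator he he1 (Finset.mem_powerset.mp hT)
  · intro T _
    refine Integrable.of_bound (Finset.measurable_fun_prod _ fun i _ =>
      (hq.comp (hXm i).norm).mul (he.comp (hXm i))).aestronglyMeasurable 1
      (Filter.Eventually.of_forall fun ω => ?_)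
    rw [Real.norm_eq_abs, Finset.abs_prod]
    refine Finset.prod_le_one (fun i _ => abs_nonneg _) fun i _ => ?_
    rw [abs_mul, abs_of_nonneg (hq01 _).1]
    exact mul_le_one₀ (hq01 _).2 (abs_nonneg _) (he1 _)
  · intro T _
    have hB : MeasurableSet {ω' | ∀ i ∈ T, J i ω' = true} := by
      have : {ω' | ∀ i ∈ T, J i ω' = true} = ⋂ i ∈ T, {ω' | J i ω' = true} := by ext; simp
      rw [this]
      exact T.measurableSet_biInter fun i _ => hJm i
    refine Integrable.of_bound ((Finset.measurable_fun_prod _ fun i _ =>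
      he.comp (hXm i)).mul (measurable_const.indicator hB)).aestronglyMeasurable 1
      (Filter.Eventually.of_forall fun ω => ?_)
    rw [norm_mul, Real.norm_eq_abs, Finset.abs_prod]
    refine mul_le_one₀ (Finset.prod_le_one (fun i _ => abs_nonneg _) fun i _ => he1 _)
      (norm_nonneg _) ?_
    exact (norm_indicator_le_norm_self _ _).trans (by simp)

instance : IsFiniteMeasure (nodeIntensity lam D) := by
  unfold nodeIntensity
  have : IsFiniteMeasure ((volume : Measure Plane).restrict (Metric.closedBall 0 D)) :=
    ⟨by
      rw [Measure.restrict_apply_univ]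
      exact measure_closedBall_lt_top (μ := (volume : Measure Plane))⟩
  exact Measure.smul_finite _ ENNReal.ofReal_ne_top

/-- The Laplace transform of the interference as the exponential of an integral over the disk. -/
theorem IsJammingNetwork.laplaceTransform_interference
    (hN : IsJammingNetwork μ lam D R₁ R₂ P N X J h)
    (hq : Measurable (jamProb R₁ R₂ P)) (hq01 : ∀ r, jamProb R₁ R₂ P r ∈ Set.Icc (0 : ℝ) 1)
    (α : ℝ) (y : Plane) {s : ℝ} (hs : 0 ≤ s) :
    laplaceTransform μ (interference α N X J h y) s
      = Real.exp (-∫ x, jamProb R₁ R₂ P ‖x‖ * (1 - (1 + s * ‖x - y‖ ^ (-α))⁻¹)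
          ∂(nodeIntensity lam D)) := by
  let c : Plane → ℝ := fun x => (1 + s * ‖x - y‖ ^ (-α))⁻¹
  have hd : Measurable fun x : Plane => s * ‖x - y‖ ^ (-α) := by fun_prop
  have hd0 : ∀ x : Plane, 0 ≤ s * ‖x - y‖ ^ (-α) := fun x => by positivity
  have hc : Measurable c := (hd.const_add 1).inv
  have hc01 : ∀ x, c x ∈ Set.Icc (0 : ℝ) 1 := fun x =>
    ⟨inv_nonneg.mpr (by linarith [hd0 x]), inv_le_one_of_one_le₀ (by linarith [hd0 x])⟩
  let t : ℕ → ℕ × (ℕ → Plane) × (ℕ → Bool) → ℝ := fun i v =>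
    if v.2.2 i = true then s * ‖v.2.1 i - y‖ ^ (-α) else 0
  have ht : ∀ i, Measurable (t i) := fun i => by
    have h1 : Measurable fun v : ℕ × (ℕ → Plane) × (ℕ → Bool) => v.2.1 i :=
      (measurable_pi_apply i).comp (measurable_fst.comp measurable_snd)
    have h2 : Measurable fun v : ℕ × (ℕ → Plane) × (ℕ → Bool) => v.2.2 i :=
      (measurable_pi_apply i).comp (measurable_snd.comp measurable_snd)
    exact (hd.comp h1).ite (h2 (measurableSet_singleton true)) measurable_const
  have ht0 : ∀ i v, 0 ≤ t i v := fun i v => by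
    simp only [t]; split_ifs
    exacts [hd0 _, le_rfl]
  have hV : Measurable fun ω => (N ω, (fun i => X i ω), fun i => J i ω) :=
    hN.poisson.measurable_card.prodMk
      ((measurable_pi_lambda _ hN.poisson.measurable_point).prodMk
        (measurable_pi_lambda _ hN.measurable_jam))
  have h1 : ∀ ω, Real.exp (-s * interference α N X J h y ω) = ∏ i ∈ Finset.range (N ω),
      Real.exp (-(t i (N ω, (fun i => X i ω), fun i => J i ω) * h i ω)) := fun ω => by
    rw [← Real.exp_sum, interference, Finset.mul_sum]
    congr 1
    refine Finset.sum_congr rfl fun i _ => ?_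
    simp only [t]; split_ifs <;> ring
  have h2 : ∀ ω i, (1 + t i (N ω, (fun i => X i ω), fun i => J i ω))⁻¹
      = if J i ω = true then c (X i ω) else 1 := fun ω i => by
    simp only [t, c]; split_ifs <;> simp
  have hf : Measurable fun x : Plane => 1 - jamProb R₁ R₂ P ‖x‖ * (1 - c x) :=
    ((hq.comp measurable_norm).mul (hc.const_sub 1)).const_sub 1
  have hf01 : ∀ x : Plane, 1 - jamProb R₁ R₂ P ‖x‖ * (1 - c x) ∈ Set.Icc (0 : ℝ) 1 := fun x => by
    have h1 := hq01 ‖x‖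
    have h2 := hc01 x
    constructor <;> nlinarith [h1.1, h1.2, h2.1, h2.2]
  rw [laplaceTransform]
  simp_rw [h1]
  rw [integral_prod_exp_neg_mul hN.measurable_fading hN.map_fading hN.iIndep_fading hV
    hN.indep_fading (n := fun v => v.1) measurable_fst ht ht0]
  simp_rw [h2]
  rw [hN.integral_prod_select hq hq01 hc hc01, hN.poisson.integral_prod hf hf01]
  simp [c]

end Thinning

/-! ### The angular integral -/

section Angular

/-- Mean value property: the function is holomorphic near the closed unit disk because |ζ| < 1, and
its value at the centre is 1. -/
lemma circleAverage_inv_one_sub_mul {ζ : ℂ} (hζ : ‖ζ‖ < 1) :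
    Real.circleAverage (fun z => (1 - ζ * z)⁻¹) 0 1 = 1 := by
  have h : DiffContOnCl ℂ (fun z : ℂ => (1 - ζ * z)⁻¹) (Metric.ball 0 |(1 : ℝ)|) := by
    refine DifferentiableOn.diffContOnCl fun z hz => ?_
    rw [abs_one, closure_ball _ one_ne_zero, mem_closedBall_zero_iff] at hz
    have hne : 1 - ζ * z ≠ 0 := fun h0 => by
      have h1 : ‖ζ * z‖ = 1 := by rw [← sub_eq_zero.mp h0, norm_one]
      rw [norm_mul] at h1
      nlinarith [norm_nonneg ζ, norm_nonneg z]
    have hd : DifferentiableAt ℂ (fun z => 1 - ζ * z) z := by fun_prop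
    exact (hd.inv hne).differentiableWithinAt
  simpa using h.circleAverage

/-- The classical integral of `1 / (A - B cos φ)` over a period. -/
lemma integral_inv_sub_mul_cos {A B S : ℂ} (hS : S ^ 2 = A ^ 2 - B ^ 2) (hS0 : S ≠ 0)
    (hB : ‖B‖ < ‖A + S‖) :
    ∫ φ in (0 : ℝ)..2 * Real.pi, (A - B * Real.cos φ)⁻¹ = 2 * Real.pi * S⁻¹ := by
  have hAS : A + S ≠ 0 := norm_pos_iff.mp ((norm_nonneg B).trans_lt hB)
  obtain ⟨ζ, hζdef⟩ : ∃ ζ, ζ = B / (A + S) := ⟨_, rfl⟩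
  have hζ : ‖ζ‖ < 1 := by
    rw [hζdef, norm_div, div_lt_one (norm_pos_iff.mpr hAS)]; exact hB
  have hBζ : B = ζ * (A + S) := by rw [hζdef]; field_simp
  have hne : ∀ z : ℂ, ‖z‖ = 1 → 1 - ζ * z ≠ 0 := fun z hz h0 => by
    have h1 : ‖ζ * z‖ = 1 := by rw [← sub_eq_zero.mp h0, norm_one]
    rw [norm_mul, hz, mul_one] at h1
    exact hζ.ne h1
  have hi1 : CircleIntegrable (fun z => (1 - ζ * z)⁻¹) 0 1 :=
    ContinuousOn.circleIntegrable zero_le_one fun z hz => by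
      have h1 : ContinuousAt (fun z : ℂ => 1 - ζ * z) z := by fun_prop
      exact (h1.inv₀ (hne z (by simpa using hz))).continuousWithinAt
  have hi2 : CircleIntegrable (fun z => (1 - ζ * z⁻¹)⁻¹) 0 1 :=
    ContinuousOn.circleIntegrable zero_le_one fun z hz => by
      have hz1 : ‖z‖ = 1 := by simpa using hz
      have hz0 : z ≠ 0 := fun h => by simp [h] at hz1
      have h1 : ContinuousAt (fun z : ℂ => 1 - ζ * z⁻¹) z := by fun_prop (disch := assumption)
      exact (h1.inv₀ (hne z⁻¹ (by simp [hz1]))).continuousWithinAt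
  -- With z = e^{iφ}, A - B cos φ = (A + S)/2 · (1 - ζz)(1 - ζ/z), because (A + S)ζ² = A - S.
  -- Partial fractions then separate the two factors; each averages to 1, the second by the symmetry
  -- z ↦ 1/z.
  have key : ∀ φ : ℝ, (A - B * Real.cos φ)⁻¹
      = S⁻¹ * ((1 - ζ * circleMap 0 1 φ)⁻¹ + (1 - ζ * (circleMap 0 1 φ)⁻¹)⁻¹ - 1) := by
    intro φ
    have hz1 : ‖circleMap 0 1 φ‖ = 1 := by simp
    obtain ⟨z, hz⟩ : ∃ z, z = circleMap 0 1 φ := ⟨_, rfl⟩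
    rw [← hz] at hz1 ⊢
    have hz0 : z ≠ 0 := fun h => by simp [h] at hz1
    have hcos : (Real.cos φ : ℂ) = (z + z⁻¹) / 2 := by
      rw [hz, circleMap_zero_inv, Complex.ofReal_cos, Complex.cos]
      simp [circleMap]
    have h1 := hne z hz1
    have h2 := hne z⁻¹ (by simp [hz1])
    have hfac : A - B * ((z + z⁻¹) / 2) = (A + S) / 2 * ((1 - ζ * z) * (1 - ζ * z⁻¹)) := by
      have hzz : z * z⁻¹ = 1 := mul_inv_cancel₀ hz0
      have h3 : (A + S) * ((A + S) * ζ ^ 2 - (A - S)) = 0 := by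
        have : ((A + S) * ζ) ^ 2 = A ^ 2 - S ^ 2 := by rw [mul_comm, ← hBζ, hS]; ring
        linear_combination this
      have h4 := (mul_eq_zero.mp h3).resolve_left hAS
      rw [hBζ]
      linear_combination (-(A + S) / 2 * ζ ^ 2) * hzz - h4 / 2
    have hone : S * 2 = (A + S) * (1 - ζ ^ 2) := by
      have h3 : (A + S) * ((A + S) * ζ ^ 2 - (A - S)) = 0 := by
        have : ((A + S) * ζ) ^ 2 = A ^ 2 - S ^ 2 := by rw [mul_comm, ← hBζ, hS]; ring
        linear_combination this
      have h4 := (mul_eq_zero.mp h3).resolve_left hAS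
      linear_combination h4
    have hsum : (1 - ζ * z)⁻¹ + (1 - ζ * z⁻¹)⁻¹ - 1
        = (1 - ζ ^ 2) * ((1 - ζ * z)⁻¹ * (1 - ζ * z⁻¹)⁻¹) := by
      have hxy : ζ ^ 2 = ζ * z * (ζ * z⁻¹) := by field_simp
      have hgen : ∀ x y : ℂ, 1 - x ≠ 0 → 1 - y ≠ 0 →
          (1 - x)⁻¹ + (1 - y)⁻¹ - 1 = (1 - x * y) * ((1 - x)⁻¹ * (1 - y)⁻¹) := by
        intro x y hx hy
        field_simp
        ring
      rw [hxy]
      exact hgen _ _ h1 h2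
    rw [hcos, hfac, hsum, mul_inv, mul_inv, ← mul_assoc S⁻¹]
    congr 1
    rw [inv_div]
    field_simp
    linear_combination hone
  have h1 := circleAverage_inv_one_sub_mul hζ
  have h2 : Real.circleAverage (fun z => (1 - ζ * z⁻¹)⁻¹) 0 1 = 1 :=
    (Real.circleAverage_zero_one_congr_inv (f := fun z => (1 - ζ * z)⁻¹)).trans h1
  have hpi : (2 * Real.pi : ℝ) ≠ 0 := by positivity
  rw [Real.circleAverage, inv_smul_eq_iff₀ hpi] at h1 h2
  have hj1 := hi1
  have hj2 := hi2
  unfold CircleIntegrable at hj1 hj2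
  simp_rw [key]
  rw [intervalIntegral.integral_const_mul, intervalIntegral.integral_sub (hj1.add hj2)
    intervalIntegrable_const, intervalIntegral.integral_add hj1 hj2, h1, h2]
  simp
  ring

/-- The angular part of the interference integral. -/
lemma integral_angular {r a s : ℝ} (hs : 0 < s) {S : ℂ}
    (hS : S ^ 2 = ((r ^ 2 + a ^ 2 : ℝ) + √s * Complex.I) ^ 2 - (2 * r * a : ℝ) ^ 2)
    (hre : 0 < S.re) (φ₀ : ℝ) :
    ∫ φ in (-Real.pi)..Real.pi, s / (s + (r ^ 2 + a ^ 2 - 2 * r * a * Real.cos (φ - φ₀)) ^ 2)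
      = 2 * Real.pi * √s * -(S⁻¹).im := by
  have hsq : √s ^ 2 = s := Real.sq_sqrt hs.le
  have hs' : 0 < √s := Real.sqrt_pos.mpr hs
  set A : ℂ := (r ^ 2 + a ^ 2 : ℝ) + √s * Complex.I with hA
  set B : ℂ := ((2 * r * a : ℝ) : ℂ) with hB
  have hS0 : S ≠ 0 := fun h => by simp [h] at hre
  -- Re S > 0 selects the correct root: |2ra| ≤ r² + a² < Re(A + S).
  have hBlt : ‖B‖ < ‖A + S‖ := by
    refine lt_of_lt_of_le ?_ (Complex.re_le_norm _)
    have h1 : (A + S).re = r ^ 2 + a ^ 2 + S.re := by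
      simp only [hA, Complex.add_re, Complex.ofReal_re, Complex.re_ofReal_mul, Complex.I_re,
        mul_zero, add_zero]
    rw [h1, hB, Complex.norm_real, Real.norm_eq_abs]
    have : |2 * r * a| ≤ r ^ 2 + a ^ 2 :=
      abs_le.mpr ⟨by nlinarith [sq_nonneg (r + a)], by nlinarith [sq_nonneg (r - a)]⟩
    linarith
  have h1 := integral_inv_sub_mul_cos hS hS0 hBlt
  have hpt : ∀ φ : ℝ, s / (s + (r ^ 2 + a ^ 2 - 2 * r * a * Real.cos φ) ^ 2)
      = -√s * ((A - B * Real.cos φ)⁻¹).im := by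
    intro φ
    have h2 : A - B * Real.cos φ
        = ((r ^ 2 + a ^ 2 - 2 * r * a * Real.cos φ : ℝ) : ℂ) + √s * Complex.I := by
      rw [hA, hB]; push_cast; ring
    rw [h2, Complex.inv_im]
    simp only [Complex.normSq_add_mul_I, Complex.add_im, Complex.ofReal_im, Complex.im_ofReal_mul,
      Complex.I_im, mul_one, zero_add]
    rw [hsq, mul_div_assoc', neg_mul_neg, ← sq, hsq, add_comm s]
  have hcont : Continuous fun φ : ℝ => (A - B * Real.cos φ)⁻¹ := by
    refine Continuous.inv₀ (by fun_prop) fun φ h0 => ?_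
    have := congrArg Complex.im h0
    simp only [hA, hB, Complex.sub_im, Complex.add_im, Complex.ofReal_im, Complex.im_ofReal_mul,
      Complex.I_im, mul_one, zero_add, mul_zero, sub_zero, Complex.zero_im] at this
    exact hs'.ne' this
  have hper : Function.Periodic
      (fun φ => s / (s + (r ^ 2 + a ^ 2 - 2 * r * a * Real.cos φ) ^ 2)) (2 * Real.pi) :=
    fun φ => by simp
  have h5 : ∫ φ in (-Real.pi)..Real.pi,
      s / (s + (r ^ 2 + a ^ 2 - 2 * r * a * Real.cos (φ - φ₀)) ^ 2)
      = ∫ φ in (0 : ℝ)..2 * Real.pi,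
        s / (s + (r ^ 2 + a ^ 2 - 2 * r * a * Real.cos φ) ^ 2) := by
    rw [intervalIntegral.integral_comp_sub_right
      (fun φ => s / (s + (r ^ 2 + a ^ 2 - 2 * r * a * Real.cos φ) ^ 2))]
    have := hper.intervalIntegral_add_eq (-Real.pi - φ₀) 0
    rw [zero_add] at this
    rw [← this]
    congr 1; ring
  rw [h5]
  simp_rw [hpt]
  rw [intervalIntegral.integral_const_mul]
  have h6 := Complex.imCLM.intervalIntegral_comp_comm (hcont.intervalIntegrable 0 (2 * Real.pi))
    (μ := volume)
  simp only [Complex.imCLM_apply] at h6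
  rw [h6, h1]
  have : (2 * (Real.pi : ℂ) * S⁻¹).im = 2 * Real.pi * (S⁻¹).im := by
    rw [← Complex.im_ofReal_mul]; push_cast; rfl
  rw [this]; ring

end Angular

/-! ### Polar coordinates -/

section Polar

lemma one_sub_inv_one_add_mul_rpow {d : ℝ} (hd : 0 < d) {s : ℝ} (hs : 0 < s) :
    1 - (1 + s * d ^ (-4 : ℝ))⁻¹ = s / (s + (d ^ 2) ^ 2) := by
  have h : d ^ (-4 : ℝ) = (d ^ 4)⁻¹ := by
    rw [Real.rpow_neg hd.le, ← Real.rpow_natCast]; norm_cast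
  rw [h]
  have h1 : 0 < d ^ 4 + s := by positivity
  have h2 : 0 < s + d ^ 4 := by positivity
  rw [← pow_mul]
  field_simp
  ring

/-- Law of cosines. For w = 0 the conventional value of `arg` is harmless, being multiplied by ‖w‖.
-/
lemma norm_polarCoord_symm_sub_sq (p : ℝ × ℝ) (w : ℂ) :
    ‖Complex.polarCoord.symm p - w‖ ^ 2
      = p.1 ^ 2 + ‖w‖ ^ 2 - 2 * p.1 * ‖w‖ * Real.cos (p.2 - w.arg) := by
  have hre : w.re = ‖w‖ * Real.cos w.arg := (Complex.norm_mul_cos_arg w).symm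
  have him : w.im = ‖w‖ * Real.sin w.arg := (Complex.norm_mul_sin_arg w).symm
  have h1 : (Complex.polarCoord.symm p - w).re = p.1 * Real.cos p.2 - ‖w‖ * Real.cos w.arg := by
    rw [← hre, Complex.polarCoord_symm_apply, Complex.sub_re, Complex.re_ofReal_mul,
      Complex.add_re, Complex.ofReal_re, Complex.re_ofReal_mul, Complex.I_re]
    ring
  have h2 : (Complex.polarCoord.symm p - w).im = p.1 * Real.sin p.2 - ‖w‖ * Real.sin w.arg := by
    rw [← him, Complex.polarCoord_symm_apply, Complex.sub_im, Complex.im_ofReal_mul,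
      Complex.add_im, Complex.ofReal_im, Complex.im_ofReal_mul, Complex.I_im]
    ring
  rw [← Complex.normSq_eq_norm_sq (_ - _), Complex.normSq_apply, h1, h2, Real.cos_sub]
  linear_combination p.1 ^ 2 * Real.sin_sq_add_cos_sq p.2
    + ‖w‖ ^ 2 * Real.sin_sq_add_cos_sq w.arg

/-- Reduction of the interference integral to a radial integral. -/
theorem integral_radial {q : ℝ → ℝ} (hq : Measurable q) (hq1 : ∀ r, |q r| ≤ 1) {R : ℝ}
    (hqR : ∀ r, R < r → q r = 0) (y : Plane) {s : ℝ} (hs : 0 < s) {S : ℝ → ℂ}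
    (hS : ∀ r, 0 < r → S r ^ 2
      = ((r ^ 2 + ‖y‖ ^ 2 : ℝ) + √s * Complex.I) ^ 2 - (2 * r * ‖y‖ : ℝ) ^ 2)
    (hre : ∀ r, 0 < r → 0 < (S r).re) :
    ∫ x : Plane, q ‖x‖ * (1 - (1 + s * ‖x - y‖ ^ (-4 : ℝ))⁻¹)
      = ∫ r in Set.Ioc 0 R, q r * (2 * Real.pi * √s * r * -((S r)⁻¹).im) := by
  set iso : ℂ ≃ₗᵢ[ℝ] Plane := Complex.orthonormalBasisOneI.repr
  set w : ℂ := iso.symm y with hw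
  have hwn : ‖w‖ = ‖y‖ := iso.symm.norm_map y
  let G : ℂ → ℝ := fun z => q ‖z‖ * (s / (s + (‖z - w‖ ^ 2) ^ 2))
  have hGm : Measurable G := by
    have h1 : Measurable fun z : ℂ => ‖z - w‖ := by fun_prop
    exact (hq.comp measurable_norm).mul
      (measurable_const.div (((h1.pow_const 2).pow_const 2).const_add s))
  have hfrac : ∀ t : ℝ, |s / (s + t ^ 2)| ≤ 1 := fun t => by
    rw [abs_of_nonneg (by positivity)]
    exact div_le_one_of_le₀ (by nlinarith [sq_nonneg t]) (by positivity)
  have h1 : ∫ x : Plane, q ‖x‖ * (1 - (1 + s * ‖x - y‖ ^ (-4 : ℝ))⁻¹) = ∫ z, G z := by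
    rw [← iso.measurePreserving.integral_comp iso.toHomeomorph.measurableEmbedding]
    refine integral_congr_ae ?_
    -- At z = w the convention 0 ^ (-4) = 0 makes the two integrands differ; that single point is
    -- null.
    filter_upwards [compl_mem_ae_iff.mpr (measure_singleton (μ := (volume : Measure ℂ)) w)]
      with z hz
    have hsub : ‖iso z - y‖ = ‖z - w‖ := by
      rw [← iso.norm_map (z - w), map_sub, hw, iso.apply_symm_apply]
    have hpos : 0 < ‖z - w‖ := norm_pos_iff.mpr (sub_ne_zero.mpr hz)
    rw [hsub, iso.norm_map, one_sub_inv_one_add_mul_rpow hpos hs]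
  have hpt : ∀ p : ℝ × ℝ, 0 < p.1 → p.1 • G (Complex.polarCoord.symm p) = p.1 * (q p.1 *
      (s / (s + (p.1 ^ 2 + ‖y‖ ^ 2 - 2 * p.1 * ‖y‖ * Real.cos (p.2 - w.arg)) ^ 2))) := by
    intro p hp
    simp only [G]
    rw [norm_polarCoord_symm_sub_sq, Complex.norm_polarCoord_symm, abs_of_pos hp, hwn, smul_eq_mul]
  let H : ℝ × ℝ → ℝ := fun p => p.1 * (q p.1 *
      (s / (s + (p.1 ^ 2 + ‖y‖ ^ 2 - 2 * p.1 * ‖y‖ * Real.cos (p.2 - w.arg)) ^ 2)))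
  have hHm : Measurable H := by
    refine measurable_fst.mul ((hq.comp measurable_fst).mul (measurable_const.div ?_))
    fun_prop
  have hsub : Set.Ioc 0 R ×ˢ Set.Ioo (-Real.pi) Real.pi ⊆ polarCoord.target := fun p hp =>
    ⟨hp.1.1, hp.2⟩
  -- Since q vanishes beyond R, a bounded rectangle suffices; there the integrand is bounded by R
  -- and Fubini applies.
  have hint : IntegrableOn H (Set.Ioc 0 R ×ˢ Set.Ioo (-Real.pi) Real.pi)
      ((volume : Measure ℝ).prod volume) := by
    refine Measure.integrableOn_of_bounded (M := R) ?_ hHm.aestronglyMeasurable ?_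
    · rw [Measure.prod_prod]
      exact ENNReal.mul_ne_top (by simp) (by simp)
    · refine (ae_restrict_iff' (measurableSet_Ioc.prod measurableSet_Ioo)).mpr
        (Filter.Eventually.of_forall fun p hp => ?_)
      simp only [H, Real.norm_eq_abs, abs_mul]
      rw [abs_of_pos hp.1.1]
      refine (mul_le_of_le_one_right hp.1.1.le ?_).trans hp.1.2
      exact mul_le_one₀ (hq1 _) (abs_nonneg _) (hfrac _)
  rw [h1, ← Complex.integral_comp_polarCoord_symm,
    setIntegral_congr_fun (g := H) polarCoord.open_target.measurableSet fun p hp => hpt p hp.1,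
    setIntegral_eq_of_subset_of_forall_sdiff_eq_zero (f := H) polarCoord.open_target.measurableSet hsub ?_,
    Measure.volume_eq_prod, setIntegral_prod _ hint]
  · refine setIntegral_congr_fun measurableSet_Ioc fun r hr => ?_
    simp only [H]
    rw [integral_const_mul, integral_const_mul, ← integral_Ioc_eq_integral_Ioo,
      ← intervalIntegral.integral_of_le (by linarith [Real.pi_pos]),
      integral_angular hs (hS r hr.1) (hre r hr.1)]
    ring
  · rintro p ⟨hp1, hp2⟩
    have hR : R < p.1 := by
      by_contra hle
      exact hp2 ⟨⟨hp1.1, not_lt.mp hle⟩, hp1.2⟩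
    simp [H, hqR _ hR]

end Polar

/-! ### The complex square root behind `eta` and `psi` -/

section Radial

/-- The number `u - a ^ 2 + i √s`. -/
noncomputable def shift (s a u : ℝ) : ℂ := (u - a ^ 2 : ℝ) + √s * Complex.I

/-- The modulus of the complex quadratic `shift ^ 2 + 4 i √s a ^ 2`. -/
noncomputable def quadNorm (s a u : ℝ) : ℝ :=
  √(((u - a ^ 2) ^ 2 - s) ^ 2 + 4 * s * (u + a ^ 2) ^ 2)

/-- The square root of `shift ^ 2 + 4 i √s a ^ 2` in the closed first quadrant; at `u = r ^ 2` its
real and imaginary parts are `eta r s a` and `psi r s a`. -/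
noncomputable def quadRoot (s a u : ℝ) : ℂ :=
  ⟨√((quadNorm s a u + ((u - a ^ 2) ^ 2 - s)) / 2),
    √((quadNorm s a u - ((u - a ^ 2) ^ 2 - s)) / 2)⟩

/-- A primitive of `1 / quadRoot`. -/
noncomputable def logPrim (s a u : ℝ) : ℂ := Complex.log (shift s a u + quadRoot s a u)

/-- A primitive of `u ^ 2 / quadRoot`. -/
noncomputable def sqPrim (s a u : ℝ) : ℂ :=
  1 / 2 * (u + 3 * (a ^ 2 - √s * Complex.I)) * quadRoot s a u
    + (a ^ 4 - s - 4 * √s * a ^ 2 * Complex.I) * logPrim s a u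

variable {s a u : ℝ}

lemma abs_le_quadNorm (hs : 0 ≤ s) : |(u - a ^ 2) ^ 2 - s| ≤ quadNorm s a u := by
  rw [quadNorm, ← Real.sqrt_sq_eq_abs]
  exact Real.sqrt_le_sqrt (le_add_of_nonneg_right (by positivity))

lemma quadRoot_re_nonneg : 0 ≤ (quadRoot s a u).re := Real.sqrt_nonneg _

lemma quadRoot_im_nonneg : 0 ≤ (quadRoot s a u).im := Real.sqrt_nonneg _

lemma quadNorm_sq (hs : 0 ≤ s) :
    quadNorm s a u ^ 2 = ((u - a ^ 2) ^ 2 - s) ^ 2 + 4 * s * (u + a ^ 2) ^ 2 :=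
  Real.sq_sqrt (by positivity)

lemma quadRoot_re_sq (hs : 0 ≤ s) :
    (quadRoot s a u).re ^ 2 = (quadNorm s a u + ((u - a ^ 2) ^ 2 - s)) / 2 :=
  Real.sq_sqrt (by linarith [neg_abs_le ((u - a ^ 2) ^ 2 - s), abs_le_quadNorm (u := u) (a := a) hs])

lemma quadRoot_im_sq (hs : 0 ≤ s) :
    (quadRoot s a u).im ^ 2 = (quadNorm s a u - ((u - a ^ 2) ^ 2 - s)) / 2 :=
  Real.sq_sqrt (by linarith [le_abs_self ((u - a ^ 2) ^ 2 - s), abs_le_quadNorm (u := u) (a := a) hs])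

/-- Both sides are nonnegative (this uses u ≥ 0) and their squares agree. This relation turns the
imaginary part into the quotient defining `psi`. -/
lemma quadRoot_re_mul_im (hs : 0 ≤ s) (hu : 0 ≤ u) :
    (quadRoot s a u).re * (quadRoot s a u).im = √s * (u + a ^ 2) := by
  have h1 : 0 ≤ (quadRoot s a u).re * (quadRoot s a u).im :=
    mul_nonneg quadRoot_re_nonneg quadRoot_im_nonneg
  have h2 : 0 ≤ √s * (u + a ^ 2) := by positivity
  rw [← sq_eq_sq₀ h1 h2, mul_pow, mul_pow, quadRoot_re_sq hs, quadRoot_im_sq hs, Real.sq_sqrt hs]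
  linear_combination quadNorm_sq (u := u) (a := a) hs / 4

lemma quadRoot_re_sq_sub_im_sq (hs : 0 ≤ s) :
    (quadRoot s a u).re ^ 2 - (quadRoot s a u).im ^ 2 = (u - a ^ 2) ^ 2 - s := by
  rw [quadRoot_re_sq hs, quadRoot_im_sq hs]; ring

lemma shift_re : (shift s a u).re = u - a ^ 2 := by
  rw [shift, Complex.add_re, Complex.ofReal_re, Complex.re_ofReal_mul, Complex.I_re]; ring

lemma shift_im : (shift s a u).im = √s := by
  rw [shift, Complex.add_im, Complex.ofReal_im, Complex.im_ofReal_mul, Complex.I_im]; ring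

lemma quadRoot_sq (hs : 0 ≤ s) (hu : 0 ≤ u) :
    quadRoot s a u ^ 2 = shift s a u ^ 2 + (4 * √s * a ^ 2 : ℝ) * Complex.I := by
  apply Complex.ext
  · rw [Complex.add_re, Complex.re_ofReal_mul, sq, sq, Complex.mul_re, Complex.mul_re, shift_re,
      shift_im, Complex.I_re]
    linear_combination quadRoot_re_sq_sub_im_sq (u := u) (a := a) hs + Real.sq_sqrt hs
  · rw [Complex.add_im, Complex.im_ofReal_mul, sq, sq, Complex.mul_im, Complex.mul_im, shift_re,
      shift_im, Complex.I_im]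
    linear_combination 2 * quadRoot_re_mul_im (a := a) hs hu

lemma quadRoot_re_pos (hs : 0 < s) (hu : 0 < u) : 0 < (quadRoot s a u).re := by
  refine quadRoot_re_nonneg.lt_of_ne' fun h => ?_
  have h1 := quadRoot_re_mul_im (a := a) hs.le hu.le
  rw [h, zero_mul] at h1
  have : 0 < √s * (u + a ^ 2) := by positivity
  linarith

/-- A vanishing imaginary part forces u = a = 0, and then the square of the real part would be -s.
Including u = 0 keeps `logPrim` continuous up to the origin, where the real part can vanish. -/
lemma quadRoot_im_pos (hs : 0 < s) (hu : 0 ≤ u) : 0 < (quadRoot s a u).im := by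
  refine quadRoot_im_nonneg.lt_of_ne' fun h => ?_
  have h1 := quadRoot_re_mul_im (a := a) hs.le hu
  have h2 := quadRoot_re_sq_sub_im_sq (u := u) (a := a) hs.le
  rw [h, mul_zero] at h1
  rw [h] at h2
  have hs' : 0 < √s := Real.sqrt_pos.mpr hs
  have h3 : u + a ^ 2 = 0 := (mul_eq_zero.mp h1.symm).resolve_left hs'.ne'
  have h4 : u = 0 := by nlinarith [sq_nonneg a]
  have h5 : a ^ 2 = 0 := by linarith
  rw [h4, h5] at h2
  nlinarith [sq_nonneg (quadRoot s a u).re]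

lemma quadRoot_ne_zero (hs : 0 < s) (hu : 0 ≤ u) : quadRoot s a u ≠ 0 := fun h =>
  (quadRoot_im_pos (a := a) hs hu).ne' (by rw [h]; rfl)

/-- Otherwise 0 < Re S ≤ a² - u. The formula for (Re S)² - (Im S)² then gives Im S ≤ √s, so the
product is at most √s(a² - u), below its value √s(a² + u). -/
lemma shift_add_quadRoot_re_pos (hs : 0 < s) (hu : 0 < u) :
    0 < (shift s a u + quadRoot s a u).re := by
  rw [Complex.add_re, shift_re]
  by_contra hle
  have h0 := quadRoot_re_pos (a := a) hs hu
  have h1 := quadRoot_re_mul_im (a := a) hs.le hu.le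
  have h2 := quadRoot_re_sq_sub_im_sq (u := u) (a := a) hs.le
  have h3 := quadRoot_im_pos (a := a) hs hu.le
  have h4 : (quadRoot s a u).re ≤ a ^ 2 - u := by linarith
  have hs' : 0 < √s := Real.sqrt_pos.mpr hs
  have h5 : (quadRoot s a u).im ≤ √s := by
    refine Real.le_sqrt_of_sq_le ?_
    nlinarith
  have h6 : (quadRoot s a u).re * (quadRoot s a u).im ≤ (a ^ 2 - u) * √s :=
    mul_le_mul h4 h5 h3.le (by linarith)
  nlinarith

lemma shift_add_quadRoot_mem_slitPlane (hs : 0 < s) (hu : 0 ≤ u) :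
    shift s a u + quadRoot s a u ∈ Complex.slitPlane := by
  refine Complex.mem_slitPlane_iff.mpr (Or.inr ?_)
  rw [Complex.add_im, shift_im]
  have := quadRoot_im_pos (a := a) hs hu
  positivity

lemma continuous_shift : Continuous (shift s a) := by unfold shift; fun_prop

lemma continuous_quadRoot : Continuous (quadRoot s a) := by
  have h : quadRoot s a = fun u =>
      ((√((quadNorm s a u + ((u - a ^ 2) ^ 2 - s)) / 2) : ℝ) : ℂ)
      + (√((quadNorm s a u - ((u - a ^ 2) ^ 2 - s)) / 2) : ℝ) * Complex.I := by
    ext u; exact Complex.mk_eq_add_mul_I _ _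
  rw [h]
  unfold quadNorm
  fun_prop

lemma continuousOn_logPrim (hs : 0 < s) : ContinuousOn (logPrim s a) (Set.Ici 0) :=
  (continuous_shift.add continuous_quadRoot).continuousOn.clog fun _ hu =>
    shift_add_quadRoot_mem_slitPlane hs hu

lemma continuousOn_sqPrim (hs : 0 < s) : ContinuousOn (sqPrim s a) (Set.Ici 0) := by
  unfold sqPrim
  refine ContinuousOn.add (Continuous.continuousOn (Continuous.mul (by fun_prop)
    continuous_quadRoot)) (continuousOn_const.mul (continuousOn_logPrim hs))

lemma hasDerivAt_shift : HasDerivAt (shift s a) 1 u := by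
  refine (((hasDerivAt_id u).sub_const (a ^ 2)).ofReal_comp.add_const (√s * Complex.I)).congr_deriv ?_
  exact Complex.ofReal_one

/-- For u > 0 the radicand has positive imaginary part and avoids the branch cut, so the root built
from real radicals is exp(log Q / 2), which can be differentiated. -/
lemma hasDerivAt_quadRoot (hs : 0 < s) (hu : 0 < u) :
    HasDerivAt (quadRoot s a) (shift s a u / quadRoot s a u) u := by
  set Q : ℝ → ℂ := fun u => shift s a u ^ 2 + (4 * √s * a ^ 2 : ℝ) * Complex.I with hQ
  have hQd : HasDerivAt Q (2 * shift s a u) u := by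
    refine (((hasDerivAt_shift (s := s) (a := a) (u := u)).pow 2).add_const
      ((4 * √s * a ^ 2 : ℝ) * Complex.I)).congr_deriv ?_
    simp
  have hQu : Q u = quadRoot s a u ^ 2 := (quadRoot_sq hs.le hu.le).symm
  have hslit : Q u ∈ Complex.slitPlane := by
    refine Complex.mem_slitPlane_iff.mpr (Or.inr ?_)
    rw [hQu, sq, Complex.mul_im]
    have h1 := quadRoot_re_pos (a := a) hs hu
    have h2 := quadRoot_im_pos (a := a) hs hu.le
    positivity
  have hroot : ∀ v, 0 < v → quadRoot s a v = Complex.exp (Complex.log (Q v) / 2) := by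
    intro v hv
    have hQv : Q v = quadRoot s a v ^ 2 := (quadRoot_sq hs.le hv.le).symm
    have hne : Q v ≠ 0 := by rw [hQv]; exact pow_ne_zero 2 (quadRoot_ne_zero hs hv.le)
    have h := Complex.sq_cpow_two_inv (quadRoot_re_pos (a := a) hs hv)
    rw [← hQv, Complex.cpow_def_of_ne_zero hne] at h
    rw [← h, div_eq_mul_inv]
  have hd := ((hQd.clog_real hslit).div_const 2).cexp
  rw [← hroot u hu, hQu] at hd
  have hne := quadRoot_ne_zero (a := a) hs hu.le
  have heq : quadRoot s a u * (2 * shift s a u / quadRoot s a u ^ 2 / 2)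
      = shift s a u / quadRoot s a u := by
    field_simp
  rw [heq] at hd
  refine hd.congr_of_eventuallyEq ?_
  filter_upwards [lt_mem_nhds hu] with v hv using hroot v hv

lemma hasDerivAt_logPrim (hs : 0 < s) (hu : 0 < u) :
    HasDerivAt (logPrim s a) (quadRoot s a u)⁻¹ u := by
  have hne := quadRoot_ne_zero (a := a) hs hu.le
  have hslit := shift_add_quadRoot_mem_slitPlane (a := a) hs hu.le
  have hne2 := Complex.slitPlane_ne_zero hslit
  have h := ((hasDerivAt_shift (s := s) (a := a)).add (hasDerivAt_quadRoot hs hu)).clog_real hslit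
  refine h.congr_deriv ?_
  rw [Pi.add_apply, div_eq_iff hne2]
  field_simp
  ring

/-- With b = a² - i√s and c = 4i√s a², write u = w + b and S² = w² + c. Integrating (w² + 2bw +
b²)/S gives (w + 4b)S/2 + (b² - c/2) log(w + S), where w + 4b = u + 3b and b² - c/2 = a⁴ - s - 4i√s
a². -/
lemma hasDerivAt_sqPrim (hs : 0 < s) (hu : 0 < u) :
    HasDerivAt (sqPrim s a) ((u : ℂ) ^ 2 * (quadRoot s a u)⁻¹) u := by
  have hne := quadRoot_ne_zero (a := a) hs hu.le
  have h1 : HasDerivAt (fun u : ℝ => (1 / 2 : ℂ) * (u + 3 * (a ^ 2 - √s * Complex.I))) (1 / 2) u := by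
    have := (((hasDerivAt_id u).ofReal_comp).add_const
      (3 * ((a : ℂ) ^ 2 - √s * Complex.I))).const_mul (1 / 2 : ℂ)
    simpa using this
  have h := (h1.mul (hasDerivAt_quadRoot (a := a) hs hu)).add
    ((hasDerivAt_logPrim (a := a) hs hu).const_mul
      ((a : ℂ) ^ 4 - s - 4 * √s * a ^ 2 * Complex.I))
  refine h.congr_deriv ?_
  have hsq := quadRoot_sq (a := a) hs.le hu.le
  have hss : (√s : ℂ) ^ 2 = s := by
    rw [← Complex.ofReal_pow, Real.sq_sqrt hs.le]
  have hI := Complex.I_sq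
  field_simp
  rw [hsq, shift]
  push_cast
  linear_combination (-2 * (√s : ℂ) ^ 2) * hI + 2 * hss

end Radial

/-! ### Real and imaginary parts of the primitives; the radial integral -/

section Values

variable {s a r : ℝ}

lemma quadRoot_re_eq_eta : (quadRoot s a (r ^ 2)).re = eta r s a := by
  rw [eta, ← Real.sqrt_div' _ zero_le_two]
  rfl

lemma quadRoot_im_eq_psi (hs : 0 < s) (hr : 0 < r) :
    (quadRoot s a (r ^ 2)).im = psi r s a := by
  have hu : 0 < r ^ 2 := by positivity
  rw [psi, ← quadRoot_re_eq_eta, eq_div_iff (quadRoot_re_pos hs hu).ne', mul_comm,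
    quadRoot_re_mul_im hs.le hu.le]

lemma shift_add_quadRoot_re :
    (shift s a (r ^ 2) + quadRoot s a (r ^ 2)).re = eta r s a + r ^ 2 - a ^ 2 := by
  rw [Complex.add_re, shift_re, quadRoot_re_eq_eta]; ring

lemma shift_add_quadRoot_im (hs : 0 < s) (hr : 0 < r) :
    (shift s a (r ^ 2) + quadRoot s a (r ^ 2)).im = √s + psi r s a := by
  rw [Complex.add_im, shift_im, quadRoot_im_eq_psi hs hr]

/-- The argument is the arctangent of the quotient because the number lies in the open right
half-plane. -/
lemma logPrim_im (hs : 0 < s) (hr : 0 < r) : (logPrim s a (r ^ 2)).im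
    = Real.arctan ((√s + psi r s a) / (eta r s a + r ^ 2 - a ^ 2)) := by
  have hu : 0 < r ^ 2 := by positivity
  have hpos := shift_add_quadRoot_re_pos (a := a) hs hu
  rw [logPrim, Complex.log_im, ← shift_add_quadRoot_re, ← shift_add_quadRoot_im hs hr]
  have h := abs_lt.mp (Complex.abs_arg_lt_pi_div_two_iff.mpr (Or.inl hpos))
  exact (Real.arctan_eq_of_tan_eq (Complex.tan_arg _) h).symm

lemma logPrim_re (hs : 0 < s) (hr : 0 < r) : (logPrim s a (r ^ 2)).re
    = Real.log ((eta r s a + r ^ 2 - a ^ 2) ^ 2 + (√s + psi r s a) ^ 2) / 2 := by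
  rw [logPrim, Complex.log_re, ← shift_add_quadRoot_re, ← shift_add_quadRoot_im hs hr,
    Complex.norm_def, Real.log_sqrt (Complex.normSq_nonneg _), Complex.normSq_apply, ← sq, ← sq]

/-- At u = 0 the real parts a² of the root and -a² of the shift cancel, leaving a positive multiple
of i. This is the source of π/2 in the theorem; the arctangent form would divide by zero here. -/
lemma logPrim_zero_im (hs : 0 < s) : (logPrim s a 0).im = Real.pi / 2 := by
  rw [logPrim, Complex.log_im, Complex.arg_eq_pi_div_two_iff]
  constructor
  · have h1 : quadNorm s a 0 = a ^ 4 + s := by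
      rw [quadNorm, Real.sqrt_eq_iff_mul_self_eq (by positivity) (by positivity)]
      ring
    have h2 : (quadRoot s a 0).re ^ 2 = (a ^ 2) ^ 2 := by
      rw [quadRoot_re_sq hs.le, h1]; ring
    have h3 := (sq_eq_sq₀ quadRoot_re_nonneg (sq_nonneg a)).mp h2
    rw [Complex.add_re, shift_re, h3]; ring
  · rw [Complex.add_im, shift_im]
    have := quadRoot_im_pos (a := a) hs le_rfl
    positivity

lemma sqPrim_im (hs : 0 < s) (hr : 0 < r) : (sqPrim s a (r ^ 2)).im
    = 1 / 2 * ((r ^ 2 + 3 * a ^ 2) * psi r s a - 3 * √s * eta r s a)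
      + (a ^ 4 - s) * Real.arctan ((√s + psi r s a) / (eta r s a + r ^ 2 - a ^ 2))
      - 2 * √s * a ^ 2
        * Real.log ((eta r s a + r ^ 2 - a ^ 2) ^ 2 + (√s + psi r s a) ^ 2) := by
  rw [← logPrim_im hs hr, ← quadRoot_im_eq_psi hs hr, ← quadRoot_re_eq_eta]
  have hlog := logPrim_re (a := a) hs hr
  rw [← quadRoot_im_eq_psi hs hr, ← quadRoot_re_eq_eta] at hlog
  rw [eq_div_iff two_ne_zero] at hlog
  rw [← hlog]
  have h1 : sqPrim s a (r ^ 2)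
      = (((r ^ 2 + 3 * a ^ 2) / 2 : ℝ) + (-(3 * √s) / 2 : ℝ) * Complex.I) * quadRoot s a (r ^ 2)
      + ((a ^ 4 - s : ℝ) + (-(4 * √s * a ^ 2) : ℝ) * Complex.I) * logPrim s a (r ^ 2) := by
    rw [sqPrim]; push_cast; ring
  rw [h1, Complex.add_im, Complex.mul_im, Complex.mul_im]
  simp only [Complex.add_re, Complex.add_im, Complex.ofReal_re, Complex.ofReal_im,
    Complex.re_ofReal_mul, Complex.im_ofReal_mul, Complex.I_re, Complex.I_im]
  ring

lemma continuousOn_radial (hs : 0 < s) (α β : ℝ) : ContinuousOn (fun r : ℝ => (α + β * r ^ 4)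
    * (2 * Real.pi * √s * r * -((quadRoot s a (r ^ 2))⁻¹).im)) Set.univ := by
  have h : Continuous fun r : ℝ => (quadRoot s a (r ^ 2))⁻¹ :=
    (continuous_quadRoot.comp (by fun_prop : Continuous fun r : ℝ => r ^ 2)).inv₀
      fun r => quadRoot_ne_zero hs (sq_nonneg r)
  have h2 : Continuous fun r : ℝ => ((quadRoot s a (r ^ 2))⁻¹).im := Complex.continuous_im.comp h
  exact Continuous.continuousOn (by fun_prop)

/-- The radial integral for selection probabilities that are affine in `r ^ 4`. -/
lemma integral_radial_affine (hs : 0 < s) (α β : ℝ) {x z : ℝ} (hx : 0 ≤ x) (hxz : x ≤ z) :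
    ∫ r in x..z, (α + β * r ^ 4) * (2 * Real.pi * √s * r * -((quadRoot s a (r ^ 2))⁻¹).im)
      = -(Real.pi * √s * (α * ((logPrim s a (z ^ 2)).im - (logPrim s a (x ^ 2)).im)
        + β * ((sqPrim s a (z ^ 2)).im - (sqPrim s a (x ^ 2)).im))) := by
  let Φ : ℝ → ℝ := fun r =>
    -(Real.pi * √s) * (α * (logPrim s a (r ^ 2)).im + β * (sqPrim s a (r ^ 2)).im)
  have hmaps : Set.MapsTo (fun r : ℝ => r ^ 2) (Set.Icc x z) (Set.Ici 0) := fun r _ => sq_nonneg r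
  have hsqc : ContinuousOn (fun r : ℝ => r ^ 2) (Set.Icc x z) := by fun_prop
  have hL : ContinuousOn (fun r => (logPrim s a (r ^ 2)).im) (Set.Icc x z) :=
    Complex.continuous_im.comp_continuousOn ((continuousOn_logPrim hs).comp hsqc hmaps)
  have hF : ContinuousOn (fun r => (sqPrim s a (r ^ 2)).im) (Set.Icc x z) :=
    Complex.continuous_im.comp_continuousOn ((continuousOn_sqPrim hs).comp hsqc hmaps)
  have hΦ : ContinuousOn Φ (Set.Icc x z) :=
    continuousOn_const.mul ((continuousOn_const.mul hL).add (continuousOn_const.mul hF))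
  have him : ∀ {f : ℝ → ℂ} {f' : ℂ} {r : ℝ}, HasDerivAt f f' (r ^ 2) →
      HasDerivAt (fun r => (f (r ^ 2)).im) (2 * r * f'.im) r := fun {f f' r} hf => by
    have h1 : HasDerivAt (fun r : ℝ => r ^ 2) (2 * r) r := by simpa using hasDerivAt_pow 2 r
    have h2 := HasDerivAt.scomp (h := fun r : ℝ => r ^ 2) r hf h1
    have h3 := Complex.imCLM.hasFDerivAt.comp_hasDerivAt r h2
    refine h3.congr_deriv ?_
    simp
  -- Differentiability is needed only inside the interval; at the endpoint x = 0 continuity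
  -- suffices.
  have hder : ∀ r ∈ Set.Ioo x z, HasDerivAt Φ
      ((α + β * r ^ 4) * (2 * Real.pi * √s * r * -((quadRoot s a (r ^ 2))⁻¹).im)) r := by
    intro r hr
    have hr0 : 0 < r := hx.trans_lt hr.1
    have hu : 0 < r ^ 2 := by positivity
    have h1 := him (hasDerivAt_logPrim (a := a) hs hu)
    have h2 := him (hasDerivAt_sqPrim (a := a) hs hu)
    refine (((h1.const_mul α).add (h2.const_mul β)).const_mul (-(Real.pi * √s))).congr_deriv ?_
    rw [← Complex.ofReal_pow, Complex.im_ofReal_mul]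
    ring
  rw [intervalIntegral.integral_eq_sub_of_hasDerivAt_of_le hxz hΦ hder
    (((continuousOn_radial hs α β).mono (Set.subset_univ _)).intervalIntegrable)]
  simp only [Φ]; ring

end Values

/-! ### Selection probabilities affine in r⁴ -/

section Policies

lemma measurable_jamProb {P : ℝ → ℝ} (hP : Measurable P) (R₁ R₂ : ℝ) :
    Measurable (jamProb R₁ R₂ P) :=
  measurable_const.ite measurableSet_Iic (hP.ite measurableSet_Iic measurable_const)

lemma jamProb_mem_Icc {P : ℝ → ℝ} {R₁ R₂ : ℝ}
    (hP : ∀ r, R₁ < r → r ≤ R₂ → P r ∈ Set.Icc (0 : ℝ) 1) (r : ℝ) :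
    jamProb R₁ R₂ P r ∈ Set.Icc (0 : ℝ) 1 := by
  unfold jamProb
  split_ifs with h1 h2
  exacts [⟨zero_le_one, le_rfl⟩, hP r (not_le.mp h1) h2, ⟨le_rfl, zero_le_one⟩]

/-- The Laplace transform of the interference for selection probabilities that are affine in the
fourth power of the distance. -/
theorem IsJammingNetwork.laplaceTransform_interference_affine
    {Ω : Type*} [MeasurableSpace Ω] {μ : Measure Ω} [IsProbabilityMeasure μ]
    {lam D R₁ R₂ : ℝ} (hlam : 0 ≤ lam) (hR₁ : 0 < R₁) (hR : R₁ ≤ R₂) (hD : R₂ ≤ D)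
    (y : Plane) {s : ℝ} (hs : 0 < s) {P : ℝ → ℝ} (hP : Measurable P)
    (hP01 : ∀ r, R₁ < r → r ≤ R₂ → P r ∈ Set.Icc (0 : ℝ) 1) {α β : ℝ}
    (hPαβ : ∀ r, R₁ < r → r ≤ R₂ → P r = α + β * r ^ 4)
    {N : Ω → ℕ} {X : ℕ → Ω → Plane} {J : ℕ → Ω → Bool} {h : ℕ → Ω → ℝ}
    (hN : IsJammingNetwork μ lam D R₁ R₂ P N X J h) :
    laplaceTransform μ (interference 4 N X J h y) s
      = Real.exp (-(lam * Real.pi * √s * (Real.pi / 2 - (logPrim s ‖y‖ (R₁ ^ 2)).im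
          - α * ((logPrim s ‖y‖ (R₂ ^ 2)).im - (logPrim s ‖y‖ (R₁ ^ 2)).im)
          - β * ((sqPrim s ‖y‖ (R₂ ^ 2)).im - (sqPrim s ‖y‖ (R₁ ^ 2)).im)))) := by
  have hq := measurable_jamProb hP R₁ R₂
  have hq01 := jamProb_mem_Icc hP01
  have hqR : ∀ r, R₂ < r → jamProb R₁ R₂ P r = 0 := fun r hr => by
    rw [jamProb, if_neg (hR.trans_lt hr).not_ge, if_neg hr.not_ge]
  rw [hN.laplaceTransform_interference hq hq01 4 y hs.le, nodeIntensity, integral_smul_measure,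
    ENNReal.toReal_ofReal hlam, smul_eq_mul,
    -- No jammers lie beyond R₂ ≤ D, so the restriction to the disk can be dropped and D disappears.
    setIntegral_eq_integral_of_forall_compl_eq_zero fun x hx => by
      rw [hqR, zero_mul]
      refine hD.trans_lt ?_
      simpa using hx,
    integral_radial hq (fun r => norm_le_one_of_mem_Icc (hq01 r)) hqR y hs
      (S := fun r => quadRoot s ‖y‖ (r ^ 2)) ?_ fun r hr => quadRoot_re_pos hs (by positivity)]
  · set K : ℝ → ℝ := fun r => 2 * Real.pi * √s * r * -((quadRoot s ‖y‖ (r ^ 2))⁻¹).im with hK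
    have hint : ∀ α β x z : ℝ, IntegrableOn (fun r => (α + β * r ^ 4) * K r) (Set.Ioc x z) :=
      fun α β x z => (((continuousOn_radial hs α β).mono (Set.subset_univ _)).integrableOn_Icc
        (a := x) (b := z)).mono_set Set.Ioc_subset_Icc_self
    -- The inner disk is the affine case with coefficients 1 and 0.
    have h1 : Set.EqOn (fun r => jamProb R₁ R₂ P r * K r) (fun r => (1 + 0 * r ^ 4) * K r)
        (Set.Ioc 0 R₁) := fun r hr => by
      simp only [jamProb, if_pos hr.2]; ring
    have h2 : Set.EqOn (fun r => jamProb R₁ R₂ P r * K r) (fun r => (α + β * r ^ 4) * K r)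
        (Set.Ioc R₁ R₂) := fun r hr => by
      simp only [jamProb, if_neg hr.1.not_ge, if_pos hr.2, hPαβ r hr.1 hr.2]
    have h3 : ∫ r in Set.Ioc 0 R₂, jamProb R₁ R₂ P r * K r
        = (∫ r in (0 : ℝ)..R₁, (1 + 0 * r ^ 4) * K r) + ∫ r in R₁..R₂, (α + β * r ^ 4) * K r := by
      rw [← Set.Ioc_union_Ioc_eq_Ioc hR₁.le hR, setIntegral_union
        (Set.Ioc_disjoint_Ioc_of_le le_rfl) measurableSet_Ioc
        ((hint 1 0 0 R₁).congr_fun h1.symm measurableSet_Ioc)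
        ((hint α β R₁ R₂).congr_fun h2.symm measurableSet_Ioc),
        setIntegral_congr_fun measurableSet_Ioc h1, setIntegral_congr_fun measurableSet_Ioc h2,
        intervalIntegral.integral_of_le hR₁.le, intervalIntegral.integral_of_le hR]
    have h4 : (logPrim s ‖y‖ (0 ^ 2)).im = Real.pi / 2 := by
      rw [zero_pow two_ne_zero, logPrim_zero_im hs]
    rw [h3, integral_radial_affine hs 1 0 le_rfl hR₁.le, integral_radial_affine hs α β hR₁.le hR,
      h4]
    congr 1; ring
  · intro r hr
    rw [quadRoot_sq hs.le (sq_nonneg r), shift]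
    push_cast
    ring

end Policies

end FriendlyJamming

theorem theorem2 {Ω : Type*} [MeasurableSpace Ω] (μ : Measure Ω) [IsProbabilityMeasure μ]
    (lam D R₁ R₂ : ℝ) (hlam : 0 ≤ lam) (hR₁ : 0 < R₁) (hR : R₁ ≤ R₂) (hD : R₂ ≤ D)
    (y : Plane) (hy : y ∈ Metric.closedBall (0 : Plane) D) (s : ℝ) (hs : 0 < s)
    (N : Ω → ℕ) (X : ℕ → Ω → Plane) (J : ℕ → Ω → Bool) (h : ℕ → Ω → ℝ) :
    (∀ p ∈ Set.Icc (0 : ℝ) 1,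
      IsJammingNetwork μ lam D R₁ R₂ (policyE p) N X J h →
        laplaceTransform μ (interference 4 N X J h y) s
          = Real.exp (-(lam * Real.pi * √s * (Real.pi / 2
              - (1 - p) * Real.arctan
                  ((√s + psi R₁ s ‖y‖) / (eta R₁ s ‖y‖ + R₁ ^ 2 - ‖y‖ ^ 2))
              - p * Real.arctan
                  ((√s + psi R₂ s ‖y‖) / (eta R₂ s ‖y‖ + R₂ ^ 2 - ‖y‖ ^ 2)))))) ∧
    (R₁ < R₂ → IsJammingNetwork μ lam D R₁ R₂ (policyI 4 R₁ R₂) N X J h →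
        laplaceTransform μ (interference 4 N X J h y) s
          = Real.exp (-(lam * Real.pi * √s * (Real.pi / 2
              - Real.arctan ((√s + psi R₁ s ‖y‖) / (eta R₁ s ‖y‖ + R₁ ^ 2 - ‖y‖ ^ 2))
              + PsiI R₁ R₂ R₂ s ‖y‖ - PsiI R₁ R₂ R₁ s ‖y‖)))) ∧
    (R₁ < R₂ → IsJammingNetwork μ lam D R₁ R₂ (policyD 4 R₁ R₂) N X J h →
        laplaceTransform μ (interference 4 N X J h y) s
          = Real.exp (-(lam * Real.pi * √s * (Real.pi / 2
              - Real.arctan ((√s + psi R₁ s ‖y‖) / (eta R₁ s ‖y‖ + R₁ ^ 2 - ‖y‖ ^ 2))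
              + PsiD R₁ R₂ R₂ s ‖y‖ - PsiD R₁ R₂ R₁ s ‖y‖)))) := by
  have hR₂ : 0 < R₂ := hR₁.trans_le hR
  have hpow : ∀ r : ℝ, r ^ (4 : ℝ) = r ^ 4 := fun r => by rw [← Real.rpow_natCast]; norm_cast
  have hle : ∀ r, R₁ < r → r ≤ R₂ → R₁ ^ 4 ≤ r ^ 4 ∧ r ^ 4 ≤ R₂ ^ 4 := fun r h1 h2 =>
    ⟨pow_le_pow_left₀ hR₁.le h1.le 4, pow_le_pow_left₀ (hR₁.trans h1).le h2 4⟩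
  refine ⟨fun p hp hN => ?_, fun hlt hN => ?_, fun hlt hN => ?_⟩
  · rw [hN.laplaceTransform_interference_affine hlam hR₁ hR hD y hs measurable_const
      (fun _ _ _ => hp) (α := p) (β := 0) (fun r _ _ => by ring),
      logPrim_im hs hR₁, logPrim_im hs hR₂]
    congr 1; ring
  · have hd : 0 < R₂ ^ 4 - R₁ ^ 4 := sub_pos.mpr (pow_lt_pow_left₀ hlt hR₁.le four_ne_zero)
    have hmeas : Measurable (policyI 4 R₁ R₂) := by unfold policyI; fun_prop
    rw [hN.laplaceTransform_interference_affine hlam hR₁ hR hD y hs hmeas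
      (fun r h1 h2 => ?_) (α := -R₁ ^ 4 / (R₂ ^ 4 - R₁ ^ 4)) (β := 1 / (R₂ ^ 4 - R₁ ^ 4))
      (fun r _ _ => by simp only [policyI, hpow]; ring),
      sqPrim_im hs hR₁, sqPrim_im hs hR₂, logPrim_im hs hR₁, logPrim_im hs hR₂, PsiI, PsiI]
    -- The θ coefficient s + R₁⁴ - a⁴ combines R₁⁴ from the constant term of the policy with the a⁴
    -- - s in `sqPrim_im`.
    · congr 1
      field_simp
      ring
    · simp only [policyI, hpow]
      exact ⟨div_nonneg (by linarith [hle r h1 h2]) hd.le,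
        div_le_one_of_le₀ (by linarith [hle r h1 h2]) hd.le⟩
  · have hd : 0 < R₂ ^ 4 - R₁ ^ 4 := sub_pos.mpr (pow_lt_pow_left₀ hlt hR₁.le four_ne_zero)
    have hmeas : Measurable (policyD 4 R₁ R₂) := by unfold policyD; fun_prop
    rw [hN.laplaceTransform_interference_affine hlam hR₁ hR hD y hs hmeas
      (fun r h1 h2 => ?_) (α := R₂ ^ 4 / (R₂ ^ 4 - R₁ ^ 4)) (β := -1 / (R₂ ^ 4 - R₁ ^ 4))
      (fun r _ _ => by simp only [policyD, hpow]; ring),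
      sqPrim_im hs hR₁, sqPrim_im hs hR₂, logPrim_im hs hR₁, logPrim_im hs hR₂, PsiD, PsiD]
    · congr 1
      field_simp
      ring
    · simp only [policyD, hpow]
      exact ⟨div_nonneg (by linarith [hle r h1 h2]) hd.le,
        div_le_one_of_le₀ (by linarith [hle r h1 h2]) hd.le⟩
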